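/- For $\theta\in(0,\pi/2)$ let $$\mathsf{Gui}(\theta)=\Big\{(r,z)\in\mathbb R^2:\ r>0,\ -\tfrac{\pi}{\sin\theta}<z,\ \max(0,z\tan\theta)<r<z\tan\theta+\tfrac{\pi}{\cos\theta}\Big\},\qquad \mathsf{Lay}(\theta)=\mathsf{Gui}(\theta)\times\mathbb S^1 ,$$ where $\mathsf{Lay}(\theta)$ carries the cylindrical coordinates $(r,z,\phi)$. For a constant $\omega\in(0,1/2]$ let $Q_{\omega,\theta}$ be the closure in $L^2(\mathsf{Lay}(\theta);r\,dr\,dz\,d\phi)$ of the quadratic form $$u\mapsto\int_{\mathsf{Lay}(\theta)}\Big(|\partial_r u|^2+|\partial_z u|^2+\frac{|i\partial_\phi u-\omega u|^2}{r^2}\Big)\,r\,dr\,dz\,d\phi,\qquad u\in C_0^\infty(\mathsf{Lay}(\theta)).$$ Let $(\pi^{[0]}u)(r,z)=(2\pi)^{-1/2}\int_0^{2\pi}u(r,z,\phi)\,d\phi$, and let $\mathsf F_{\omega,\theta}$ be the self-adjoint operator in $L^2(\mathsf{Gui}(\theta);r\,dr\,dz)$ associated with the closed non-negative quadratic form $$\mathfrak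 f_{\omega,\theta}[u]=\int_{\mathsf{Gui}(\theta)}\Big(|\partial_r u|^2+|\partial_z u|^2+\frac{\omega^2}{r^2}|u|^2\Big)\,r\,dr\,dz,\qquad \mathrm{dom}\,\mathfrak f_{\omega,\theta}=\pi^{[0]}(\mathrm{dom}\,Q_{\omega,\theta}),$$ where $\partial_r u,\partial_z u$ are weak derivatives. For $k\in\{1,2,\dots\}$ the $k$-th Rayleigh quotient of $\mathsf F_{\omega,\theta}$ is $$E_k(\mathsf F_{\omega,\theta})=\sup_{u_1,\dots,u_{k-1}\in\mathrm{dom}\,\mathfrak f_{\omega,\theta}}\ \inf_{\substack{u\in\mathrm{dom}\,\mathfrak f_{\omega,\theta}\setminus\{0\}\\ u\perp u_1,\dots,u_{k-1}}}\ \frac{\mathfrak f_{\omega,\theta}[u]}{\|u\|^2_{L^2(\mathsf{Gui}(\theta);r\,dr\,dz)}} .$$ Let $0<\theta_1\le\theta_2<\pi/2$, $\omega_1\in(0,1/2]$ and $\omega_2\in\big[\tfrac{\cos\theta_2}{\cos\theta_1}\,\omega_1,\,1/2\big]$. Then $$E_k(\mathsf F_{\omega_1,\theta_1})\le E_k(\mathsf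 F_{\omega_2,\theta_2})\qquad\text{for all } k\in\{1,2,\dots\}.$$ -/

import Mathlib

open MeasureTheory Filter Topology

noncomputable section

namespace ConicalLayer

/-- The meridian domain `Gui(θ)` of the conical layer; points are pairs `(r, z)`. -/
def Gui (θ : ℝ) : Set (ℝ × ℝ) :=
  {p | 0 < p.1 ∧ -(Real.pi / Real.sin θ) < p.2 ∧ max 0 (p.2 * Real.tan θ) < p.1 ∧
    p.1 < p.2 * Real.tan θ + Real.pi / Real.cos θ}

/-- The measure `r dr dz` on `Gui(θ)`. -/
def guiMeasure (θ : ℝ) : Measure (ℝ × ℝ) :=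
  (volume.restrict (Gui θ)).withDensity (fun p => ENNReal.ofReal p.1)

/-- The measure `r dr dz dφ` on the layer `Lay(θ) = Gui(θ) × 𝕊¹`. The circle is parametrized by
`φ ∈ (0, 2π]`, and points are written `((r, z), φ)`. -/
def layMeasure (θ : ℝ) : Measure ((ℝ × ℝ) × ℝ) :=
  (guiMeasure θ).prod (volume.restrict (Set.Ioc 0 (2 * Real.pi)))

/-- The Hilbert space `L²(Gui(θ); r dr dz)`. -/
abbrev L2Gui (θ : ℝ) : Type := Lp ℂ 2 (guiMeasure θ)

/-- The Hilbert space `L²_cyl(Lay(θ)) = L²(Gui(θ) × 𝕊¹; r dr dz dφ)`. -/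
abbrev L2Lay (θ : ℝ) : Type := Lp ℂ 2 (layMeasure θ)

/-- `C_0^∞(Lay(θ))`: smooth functions of `((r, z), φ)` that are `2π`-periodic in `φ` and vanish
when `(r, z)` is outside some compact subset of `Gui(θ)`. -/
def IsLayTestFunction (θ : ℝ) (u : (ℝ × ℝ) × ℝ → ℂ) : Prop :=
  ContDiff ℝ ((⊤ : ℕ∞) : WithTop ℕ∞) u ∧
  (∀ p φ, u (p, φ + 2 * Real.pi) = u (p, φ)) ∧
  ∃ K : Set (ℝ × ℝ), IsCompact K ∧ K ⊆ Gui θ ∧ ∀ p, p ∉ K → ∀ φ, u (p, φ) = 0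

/-- The magnetic form `‖(i∇ - A_ω) u‖²` for `A_ω = (ω / r) e_φ`, with `ω` constant, on
`C_0^∞(Lay(θ))`, written in cylindrical coordinates. -/
def layForm₀ (ω θ : ℝ) (u : (ℝ × ℝ) × ℝ → ℂ) : ℝ :=
  ∫ x, (‖fderiv ℝ u x ((1, 0), 0)‖ ^ 2 + ‖fderiv ℝ u x ((0, 1), 0)‖ ^ 2 +
    ‖Complex.I * fderiv ℝ u x ((0, 0), 1) - (ω : ℂ) * u x‖ ^ 2 / x.1.1 ^ 2) ∂(layMeasure θ)

/-- The domain of the closure of the form `layForm₀ ω θ` with domain `C_0^∞(Lay(θ))`: those `u` in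
the Hilbert space that are `L²`-limits of a sequence in `C_0^∞(Lay(θ))` which is Cauchy with
respect to the form. -/
def layFormDomain (ω θ : ℝ) : Set (L2Lay θ) :=
  {u | ∃ w : ℕ → (ℝ × ℝ) × ℝ → ℂ, (∀ n, IsLayTestFunction θ (w n)) ∧
    Tendsto (fun n => eLpNorm (fun x => w n x - u x) 2 (layMeasure θ)) atTop (𝓝 0) ∧
    Tendsto (fun p : ℕ × ℕ => layForm₀ ω θ (fun x => w p.1 x - w p.2 x)) atTop (𝓝 0)}

/-- The projection `π^[0]`: the pairing on the circle with `v₀ = (2π)^(-1/2)`. -/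
def axisymmetricProj (u : (ℝ × ℝ) × ℝ → ℂ) (p : ℝ × ℝ) : ℂ :=
  ∫ φ in Set.Ioc 0 (2 * Real.pi), u (p, φ) * ((1 / Real.sqrt (2 * Real.pi) : ℝ) : ℂ)

/-- `g` is the weak derivative of `u` in the direction `v` on the open set `U`. -/
def IsWeakDeriv (U : Set (ℝ × ℝ)) (u g : ℝ × ℝ → ℂ) (v : ℝ × ℝ) : Prop :=
  LocallyIntegrableOn u U ∧ LocallyIntegrableOn g U ∧
  ∀ η : ℝ × ℝ → ℝ, ContDiff ℝ ((⊤ : ℕ∞) : WithTop ℕ∞) η → HasCompactSupport η → tsupport η ⊆ U →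
    ∫ x in U, fderiv ℝ η x v • u x = -∫ x in U, η x • g x

open Classical in
/-- The weak derivative of `u` in the direction `v` on `U` (unique up to null sets), and zero if
there is none. -/
def weakDeriv (U : Set (ℝ × ℝ)) (u : ℝ × ℝ → ℂ) (v : ℝ × ℝ) : ℝ × ℝ → ℂ :=
  if h : ∃ g, IsWeakDeriv U u g v then h.choose else 0

/-- The domain `π^[0](dom Q_{ω,θ})` of the form of the axisymmetric fiber `F_{ω,θ}`. -/
def fiberDomain (ω θ : ℝ) : Set (L2Gui θ) :=
  {g | ∃ u ∈ layFormDomain ω θ, g =ᵐ[guiMeasure θ] axisymmetricProj u}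

/-- The form of the axisymmetric fiber `F_{ω,θ}`:
`∫ (|∂_r u|² + |∂_z u|² + ω² |u|² / r²) r dr dz` over `Gui(θ)`. -/
def fiberForm (ω θ : ℝ) (u : L2Gui θ) : ℝ :=
  ∫ p, (‖weakDeriv (Gui θ) u (1, 0) p‖ ^ 2 + ‖weakDeriv (Gui θ) u (0, 1) p‖ ^ 2 +
    ω ^ 2 / p.1 ^ 2 * ‖u p‖ ^ 2) ∂(guiMeasure θ)

/-- The `k`-th Rayleigh quotient (`k ≥ 1`) of the form `t` with domain `D`, which is by definition
that of the self-adjoint operator associated with the form: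
the supremum over `u₁, …, u_{k-1} ∈ D` of the infimum of `t[u] / ‖u‖²` over nonzero `u ∈ D`
orthogonal to `u₁, …, u_{k-1}`. -/
def rayleighQuotient {H : Type*} [NormedAddCommGroup H] [InnerProductSpace ℂ H]
    (D : Set H) (t : H → ℝ) (k : ℕ) : EReal :=
  ⨆ v : Fin (k - 1) → D,
    ⨅ u ∈ {u : H | u ∈ D ∧ u ≠ 0 ∧ u ∈ (Submodule.span ℂ (Set.range fun i => (v i : H)))ᗮ},
      ((t u / ‖u‖ ^ 2 : ℝ) : EReal)

/-- `E_k(F_{ω,θ})`. -/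
def fiberRayleigh (ω θ : ℝ) (k : ℕ) : EReal :=
  rayleighQuotient (fiberDomain ω θ) (fiberForm ω θ) k

end ConicalLayer

end

/-!
Averaging over the circle is an `L²` contraction that does not increase the form, and it maps
`C_0^∞(Lay(θ))` onto `C_0^∞(Gui(θ))` with the axisymmetric extension as a right inverse; hence the
domain of the fiber is the closure of `C_0^∞(Gui(θ))` for the form, on which weak derivatives are
limits of classical ones.

In the coordinates `d = r cos θ - z sin θ`, the distance to the lower side, and
`t = r sin θ + z cos θ`, the position along the sides, `Gui(θ)` is given by `r > 0` and `0 < d < π`.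
Multiplying `t` by `tan θ₁ / tan θ₂ ≤ 1` therefore maps `Gui(θ₁)` onto `Gui(θ₂)`, multiplies `r` by
`cos θ₂ / cos θ₁` and scales the measure `r dr dz` by a constant. Composition with this stretch is
unitary up to a scalar and exchanges the form domains; it leaves the normal derivative alone,
shrinks the tangential one, and turns the potential `ω₁² / r²` into
`((cos θ₂ / cos θ₁) ω₁)² / r² ≤ ω₂² / r²`. The min-max values are thus ordered.
-/

noncomputable section

namespace ConicalLayer

section ParametricIntegral

variable {G : Type*} [NormedAddCommGroup G] [MeasurableSpace G] [BorelSpace G]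
  {ν : Measure G} [IsFiniteMeasure ν] {k : Set G}

theorem integrable_of_continuous_of_ae_mem_isCompact {F : Type*} [NormedAddCommGroup F]
    (hk : IsCompact k) (hν : ∀ᵐ y ∂ν, y ∈ k) {f : G → F} (hf : Continuous f) :
    Integrable f ν := by
  rw [← Measure.restrict_eq_self_of_ae_mem hν]
  exact hf.continuousOn.integrableOn_compact hk

universe u

variable [NormedSpace ℝ G] {E : Type u} [NormedAddCommGroup E] [NormedSpace ℝ E]

theorem hasFDerivAt_integral_of_isCompact {F : Type*} [NormedAddCommGroup F] [NormedSpace ℝ F]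
    (hk : IsCompact k) (hν : ∀ᵐ y ∂ν, y ∈ k) {f : E × G → F} (hf : ContDiff ℝ 1 f) (x : E) :
    HasFDerivAt (fun x => ∫ y, f (x, y) ∂ν)
      (∫ y, (fderiv ℝ f (x, y)).comp (ContinuousLinearMap.inl ℝ E G) ∂ν) x := by
  have hf' : Continuous fun z => (fderiv ℝ f z).comp (ContinuousLinearMap.inl ℝ E G) :=
    (hf.continuous_fderiv one_ne_zero).clm_comp continuous_const
  obtain ⟨C, hC⟩ := hk.exists_bound_of_continuousOn
    (hf'.comp (Continuous.prodMk_right x)).continuousOn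
  have hbound : ∀ᶠ x' in 𝓝 x, ∀ y ∈ k,
      ‖(fderiv ℝ f (x', y)).comp (ContinuousLinearMap.inl ℝ E G)‖ ≤ C + 1 :=
    hk.eventually_forall_of_forall_eventually fun y hy =>
      (hf'.norm.continuousAt.eventually_lt continuousAt_const
        ((hC y hy).trans_lt (lt_add_one C))).mono fun _ => le_of_lt
  have hint : ∀ x', Integrable (fun y => f (x', y)) ν := fun x' =>
    integrable_of_continuous_of_ae_mem_isCompact hk hν
      (hf.continuous.comp (Continuous.prodMk_right x'))
  have hint' := integrable_of_continuous_of_ae_mem_isCompact hk hν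
    (hf'.comp (Continuous.prodMk_right x))
  refine hasFDerivAt_integral_of_dominated_of_fderiv_le (𝕜 := ℝ) hbound
    (Eventually.of_forall fun x' => (hint x').aestronglyMeasurable)
    (hint x) hint'.aestronglyMeasurable
    (hν.mono fun y hy x' hx' => hx' y hy) (integrable_const (C + 1))
    (Eventually.of_forall fun y x' _ => ?_)
  exact (hf.differentiable one_ne_zero (x', y)).hasFDerivAt.comp x' (hasFDerivAt_prodMk_left x' y)

theorem contDiff_integral_of_isCompact {F : Type u} [NormedAddCommGroup F] [NormedSpace ℝ F]
    (hk : IsCompact k) (hν : ∀ᵐ y ∂ν, y ∈ k) {f : E × G → F}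
    (hf : ContDiff ℝ ((⊤ : ℕ∞) : WithTop ℕ∞) f) :
    ContDiff ℝ ((⊤ : ℕ∞) : WithTop ℕ∞) fun x => ∫ y, f (x, y) ∂ν := by
  refine contDiff_infty.2 fun n => ?_
  induction n generalizing F with
  | zero =>
    have h := hasFDerivAt_integral_of_isCompact hk hν (hf.of_le (by exact_mod_cast le_top))
    exact contDiff_zero.2 (continuous_iff_continuousAt.2 fun x => (h x).continuousAt)
  | succ n ih =>
    have h := hasFDerivAt_integral_of_isCompact hk hν (hf.of_le (by exact_mod_cast le_top))
    push_cast
    refine contDiff_succ_iff_fderiv.2 ⟨fun x => (h x).differentiableAt, by simp, ?_⟩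
    rw [funext fun x => (h x).fderiv]
    exact ih ((hf.fderiv_right (m := ((⊤ : ℕ∞) : WithTop ℕ∞)) (by simp)).clm_comp contDiff_const)

end ParametricIntegral

section SquareIntegrable

variable {α : Type*} {m : MeasurableSpace α} {μ : Measure α} {E : Type*} [NormedAddCommGroup E]

theorem eLpNorm_two_sq (μ : Measure α) (f : α → E) :
    eLpNorm f 2 μ ^ 2 = ∫⁻ x, ‖f x‖ₑ ^ 2 ∂μ := by
  rw [eLpNorm_eq_lintegral_rpow_enorm_toReal two_ne_zero ENNReal.ofNat_ne_top,
    ← ENNReal.rpow_natCast, ← ENNReal.rpow_mul]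
  norm_num

theorem integral_norm_sq_eq_sq_eLpNorm {f : α → E} (hf : MemLp f 2 μ) :
    ∫ x, ‖f x‖ ^ 2 ∂μ = (eLpNorm f 2 μ).toReal ^ 2 := by
  rw [← ENNReal.toReal_pow, eLpNorm_two_sq,
    integral_eq_lintegral_of_nonneg_ae (Eventually.of_forall fun _ => by positivity)
      (by exact hf.1.norm.pow 2)]
  simp only [ENNReal.ofReal_pow (norm_nonneg _), ofReal_norm]

theorem enorm_integral_sq_le [NormedSpace ℝ E] {f : α → E} (hf : AEStronglyMeasurable f μ) :
    ‖∫ x, f x ∂μ‖ₑ ^ 2 ≤ μ Set.univ * ∫⁻ x, ‖f x‖ₑ ^ 2 ∂μ := by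
  have hHolder : ∫⁻ x, ‖f x‖ₑ ∂μ ≤ eLpNorm f 2 μ * μ Set.univ ^ (1 / 2 : ℝ) := by
    have h := eLpNorm_le_eLpNorm_mul_rpow_measure_univ (p := 1) (q := 2) (by norm_num) hf
    norm_num [eLpNorm_one_eq_lintegral_enorm] at h ⊢
    exact h
  calc ‖∫ x, f x ∂μ‖ₑ ^ 2 ≤ (eLpNorm f 2 μ * μ Set.univ ^ (1 / 2 : ℝ)) ^ 2 := by
        gcongr
        exact (enorm_integral_le_lintegral_enorm f).trans hHolder
    _ = μ Set.univ * ∫⁻ x, ‖f x‖ₑ ^ 2 ∂μ := by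
        rw [mul_pow, eLpNorm_two_sq, mul_comm, ← ENNReal.rpow_natCast, ← ENNReal.rpow_mul]
        norm_num

theorem ae_eq_mul_of_tendsto_Lp {𝕜 : Type*} [NormedRing 𝕜] {p : ENNReal} [Fact (1 ≤ p)]
    {a : α → 𝕜} {f F : ℕ → Lp 𝕜 p μ} {g G : Lp 𝕜 p μ}
    (hF : ∀ n, F n =ᵐ[μ] fun x => a x * f n x) (hf : Tendsto f atTop (𝓝 g))
    (hG : Tendsto F atTop (𝓝 G)) : G =ᵐ[μ] fun x => a x * g x := by
  obtain ⟨ns, hns, hae⟩ := (tendstoInMeasure_of_tendsto_Lp hf).exists_seq_tendsto_ae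
  obtain ⟨ms, hms, hae'⟩ := (tendstoInMeasure_of_tendsto_Lp
    (hG.comp hns.tendsto_atTop)).exists_seq_tendsto_ae
  filter_upwards [hae, hae', ae_all_iff.2 hF] with x hg hG hFx
  refine tendsto_nhds_unique (hG.congr fun n => hFx _) ?_
  exact (hg.comp hms.tendsto_atTop).const_mul (a x)

end SquareIntegrable

section RayleighQuotient

variable {H₁ H₂ : Type*} [NormedAddCommGroup H₁] [InnerProductSpace ℂ H₁]
  [NormedAddCommGroup H₂] [InnerProductSpace ℂ H₂]

theorem mem_orthogonal_span_range_iff {ι : Type*} {v : ι → H₁} {x : H₁} :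
    x ∈ (Submodule.span ℂ (Set.range v))ᗮ ↔ ∀ i, inner ℂ (v i) x = 0 := by
  rw [← Submodule.span_singleton_le_iff_mem, ← Submodule.isOrtho_iff_le, Submodule.isOrtho_comm,
    Submodule.isOrtho_span]
  simp

theorem rayleighQuotient_le_of_equiv {D₁ : Set H₁} {D₂ : Set H₂} {t₁ : H₁ → ℝ} {t₂ : H₂ → ℝ}
    (T : H₂ ≃ H₁) {κ : ℝ} (hκ : 0 < κ) (hinner : ∀ x y, inner ℂ (T x) (T y) = κ * inner ℂ x y)
    (hD : ∀ u, T u ∈ D₁ ↔ u ∈ D₂) (ht : ∀ u ∈ D₂, t₁ (T u) ≤ κ * t₂ u) (k : ℕ) :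
    rayleighQuotient D₁ t₁ k ≤ rayleighQuotient D₂ t₂ k := by
  have hnorm : ∀ u, ‖T u‖ ^ 2 = κ * ‖u‖ ^ 2 := fun u => by
    rw [← inner_self_eq_norm_sq (𝕜 := ℂ), hinner, ← inner_self_eq_norm_sq (𝕜 := ℂ)]
    exact Complex.re_ofReal_mul _ _
  refine iSup_le fun v => le_iSup_of_le
    (fun i => ⟨T.symm (v i), (hD _).1 ((T.apply_symm_apply _).symm ▸ (v i).2)⟩) ?_
  refine le_iInf₂ fun u ⟨huD, hu0, hu⟩ => iInf₂_le_of_le (T u) ⟨(hD u).2 huD, ?_, ?_⟩ ?_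
  · rw [← norm_ne_zero_iff, ← sq_pos_iff, hnorm]
    positivity
  · rw [mem_orthogonal_span_range_iff] at hu ⊢
    intro i
    rw [← T.apply_symm_apply (v i), hinner, hu i, mul_zero]
  · rw [EReal.coe_le_coe_iff, hnorm, ← mul_div_mul_left (t₂ u) _ hκ.ne']
    gcongr
    exact ht u huD

end RayleighQuotient

section WeakDerivative

variable {U : Set (ℝ × ℝ)} {u u' g g' : ℝ × ℝ → ℂ} {v : ℝ × ℝ}

theorem setIntegral_smul_of_tsupport_subset {η : ℝ × ℝ → ℝ} (hη : tsupport η ⊆ U)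
    (f : ℝ × ℝ → ℂ) : ∫ x in U, η x • f x = ∫ x, η x • f x :=
  setIntegral_eq_integral_of_forall_compl_eq_zero fun x hx => by
    rw [image_eq_zero_of_notMem_tsupport fun h => hx (hη h), zero_smul]

theorem integrable_smul_of_tsupport_subset {η : ℝ × ℝ → ℝ} (hη : Continuous η)
    (hc : HasCompactSupport η) (hU : tsupport η ⊆ U) (hu : LocallyIntegrableOn u U) :
    Integrable fun x => η x • u x :=
  ((hu.integrableOn_compact_subset hU hc).continuousOn_smul
    hη.continuousOn hc).integrable_of_forall_notMem_eq_zero fun x hx => by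
      rw [image_eq_zero_of_notMem_tsupport hx, zero_smul]

theorem isWeakDeriv_fderiv (hu : ContDiff ℝ 1 u) (U : Set (ℝ × ℝ)) (v : ℝ × ℝ) :
    IsWeakDeriv U u (fun x => fderiv ℝ u x v) v := by
  have hu' : Continuous fun x => fderiv ℝ u x v :=
    (hu.continuous_fderiv one_ne_zero).clm_apply continuous_const
  refine ⟨hu.continuous.locallyIntegrable.locallyIntegrableOn U,
    hu'.locallyIntegrable.locallyIntegrableOn U, fun η hη hc hs => ?_⟩
  have hη' : Continuous fun x => fderiv ℝ η x v :=
    (hη.continuous_fderiv (by simp)).clm_apply continuous_const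
  have hc' : HasCompactSupport fun x => fderiv ℝ η x v := hc.fderiv_apply ℝ v
  rw [setIntegral_smul_of_tsupport_subset ((tsupport_fderiv_apply_subset ℝ v).trans hs),
    setIntegral_smul_of_tsupport_subset hs, integral_smul_fderiv_eq_neg_fderiv_smul_of_integrable
      ((hη'.smul hu.continuous).integrable_of_hasCompactSupport hc'.smul_right)
      ((hη.continuous.smul hu').integrable_of_hasCompactSupport hc.smul_right)
      ((hη.continuous.smul hu.continuous).integrable_of_hasCompactSupport hc.smul_right)
      (fun x _ => hη.differentiable (by simp) x)
      (fun x _ => hu.differentiable one_ne_zero x), neg_neg]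

theorem IsWeakDeriv.congr (h : IsWeakDeriv U u g v) (hu : u =ᵐ[volume.restrict U] u')
    (hg : g =ᵐ[volume.restrict U] g') : IsWeakDeriv U u' g' v := by
  refine ⟨h.1.congr hu, h.2.1.congr hg, fun η hη hc hs => ?_⟩
  have hu_int : ∫ x in U, fderiv ℝ η x v • u' x = ∫ x in U, fderiv ℝ η x v • u x :=
    integral_congr_ae (hu.mono fun x hx => congrArg (fderiv ℝ η x v • ·) hx.symm)
  have hg_int : ∫ x in U, η x • g' x = ∫ x in U, η x • g x :=
    integral_congr_ae (hg.mono fun x hx => congrArg (η x • ·) hx.symm)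
  rw [hu_int, hg_int, h.2.2 η hη hc hs]

theorem IsWeakDeriv.ae_eq (hU : IsOpen U) (h : IsWeakDeriv U u g v) (h' : IsWeakDeriv U u g' v) :
    g =ᵐ[volume.restrict U] g' := by
  have hsub : ∀ᵐ x, x ∈ U → g x - g' x = 0 := by
    refine hU.ae_eq_zero_of_integral_contDiff_smul_eq_zero (h.2.1.sub h'.2.1) fun η hη hc hs => ?_
    have heq : ∫ x, η x • g x = ∫ x, η x • g' x := by
      rw [← setIntegral_smul_of_tsupport_subset hs, ← setIntegral_smul_of_tsupport_subset hs,
        ← neg_inj, ← h.2.2 η hη hc hs, ← h'.2.2 η hη hc hs]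
    simp only [smul_sub]
    rw [integral_sub (integrable_smul_of_tsupport_subset hη.continuous hc hs h.2.1)
      (integrable_smul_of_tsupport_subset hη.continuous hc hs h'.2.1), heq, sub_self]
  exact (ae_restrict_iff' hU.measurableSet).2 (hsub.mono fun x hx hxU => sub_eq_zero.1 (hx hxU))

theorem IsWeakDeriv.weakDeriv_ae_eq (hU : IsOpen U) (h : IsWeakDeriv U u g v) :
    weakDeriv U u v =ᵐ[volume.restrict U] g := by
  have hex : ∃ g, IsWeakDeriv U u g v := ⟨g, h⟩
  rw [weakDeriv, dif_pos hex]
  exact hex.choose_spec.ae_eq hU h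

end WeakDerivative

section MeridianDomain

variable {θ : ℝ}

theorem isOpen_Gui (θ : ℝ) : IsOpen (Gui θ) := by
  simp only [Gui, Set.ofPred_and]
  exact (isOpen_lt (by fun_prop) (by fun_prop)).inter
    ((isOpen_lt (by fun_prop) (by fun_prop)).inter
      ((isOpen_lt (by fun_prop) (by fun_prop)).inter (isOpen_lt (by fun_prop) (by fun_prop))))

instance (θ : ℝ) : IsLocallyFiniteMeasure (guiMeasure θ) :=
  IsLocallyFiniteMeasure.withDensity_ofReal (by fun_prop)

instance (θ : ℝ) : SFinite (guiMeasure θ) := by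
  unfold guiMeasure
  infer_instance

theorem restrict_Gui_absolutelyContinuous_guiMeasure (θ : ℝ) :
    volume.restrict (Gui θ) ≪ guiMeasure θ := by
  refine withDensity_absolutelyContinuous' (by fun_prop) ?_
  filter_upwards [ae_restrict_mem (isOpen_Gui θ).measurableSet] with p hp
  simpa only [ne_eq, ENNReal.ofReal_eq_zero, not_le] using hp.1

theorem guiMeasure_absolutelyContinuous_restrict_Gui (θ : ℝ) :
    guiMeasure θ ≪ volume.restrict (Gui θ) :=
  withDensity_absolutelyContinuous _ _

theorem integral_guiMeasure {E : Type*} [NormedAddCommGroup E] [NormedSpace ℝ E] (θ : ℝ)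
    (f : ℝ × ℝ → E) : ∫ p, f p ∂guiMeasure θ = ∫ p in Gui θ, p.1 • f p := by
  rw [guiMeasure, integral_withDensity_eq_integral_toReal_smul (by fun_prop) (by simp)]
  refine setIntegral_congr_fun (isOpen_Gui θ).measurableSet fun p hp => ?_
  simp only [ENNReal.toReal_ofReal hp.1.le]

theorem locallyIntegrableOn_Gui_of_memLp {E : Type*} [NormedAddCommGroup E] [NormedSpace ℝ E]
    {q : ENNReal} (hq : 1 ≤ q) {f : ℝ × ℝ → E} (hf : MemLp f q (guiMeasure θ)) :
    LocallyIntegrableOn f (Gui θ) := by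
  refine (locallyIntegrableOn_iff (isOpen_Gui θ).isLocallyClosed).2 fun K hKG hK => ?_
  have hint : IntegrableOn f K (guiMeasure θ) :=
    (hf.locallyIntegrable hq).integrableOn_isCompact hK
  rw [IntegrableOn, guiMeasure, restrict_withDensity hK.measurableSet,
    Measure.restrict_restrict_of_subset hKG,
    integrable_withDensity_iff_integrable_smul' (by fun_prop) (by simp)] at hint
  have hinv : ContinuousOn (fun p : ℝ × ℝ => p.1⁻¹) K :=
    continuousOn_fst.inv₀ fun p hp => (hKG hp).1.ne'
  refine (IntegrableOn.continuousOn_smul hint hinv hK).congr_fun (fun p hp => ?_) hK.measurableSet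
  have hr := (hKG hp).1
  simp only [smul_smul, ENNReal.toReal_ofReal hr.le, inv_mul_cancel₀ hr.ne', one_smul]

theorem tendsto_setIntegral_Gui_smul {ψ : ℝ × ℝ → ℝ} (hψ : Continuous ψ)
    (hc : HasCompactSupport ψ) (hs : tsupport ψ ⊆ Gui θ) {f : ℕ → L2Gui θ} {g : L2Gui θ}
    (hf : Tendsto f atTop (𝓝 g)) :
    Tendsto (fun n => ∫ p in Gui θ, ψ p • f n p) atTop (𝓝 (∫ p in Gui θ, ψ p • g p)) := by
  have hquot : Continuous fun p : ℝ × ℝ => p.1⁻¹ * ψ p := by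
    refine ContinuousOn.continuous_of_tsupport_subset (s := Gui θ) ?_ (isOpen_Gui θ)
      (tsupport_mul_subset_right.trans hs)
    exact (continuousOn_fst.inv₀ fun p hp => hp.1.ne').mul hψ.continuousOn
  have hmem : MemLp (fun p => ((p.1⁻¹ * ψ p : ℝ) : ℂ)) 2 (guiMeasure θ) :=
    (Continuous.memLp_of_hasCompactSupport hquot hc.mul_left).ofReal
  have hinner : ∀ h : L2Gui θ, inner ℂ hmem.toLp h = ∫ p in Gui θ, ψ p • h p := fun h => by
    rw [L2.inner_def]
    trans ∫ p, (p.1⁻¹ * ψ p) • h p ∂guiMeasure θ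
    · refine integral_congr_ae ?_
      filter_upwards [hmem.coeFn_toLp] with p hp
      rw [hp, RCLike.inner_apply, Complex.conj_ofReal, Complex.real_smul, mul_comm]
    · rw [integral_guiMeasure]
      refine setIntegral_congr_fun (isOpen_Gui θ).measurableSet fun p hp => ?_
      simp only [smul_smul, mul_inv_cancel_left₀ hp.1.ne']
  simp only [← hinner]
  exact tendsto_const_nhds.inner hf

theorem IsWeakDeriv.of_tendsto {f f' : ℕ → L2Gui θ} {g g' : L2Gui θ} {v : ℝ × ℝ}
    (h : ∀ n, IsWeakDeriv (Gui θ) (f n) (f' n) v) (hf : Tendsto f atTop (𝓝 g))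
    (hf' : Tendsto f' atTop (𝓝 g')) : IsWeakDeriv (Gui θ) g g' v := by
  refine ⟨locallyIntegrableOn_Gui_of_memLp one_le_two (Lp.memLp g),
    locallyIntegrableOn_Gui_of_memLp one_le_two (Lp.memLp g'), fun η hη hc hs => ?_⟩
  have hη' : Continuous fun p => fderiv ℝ η p v :=
    (hη.continuous_fderiv (by simp)).clm_apply continuous_const
  have hlim := tendsto_setIntegral_Gui_smul hη' (hc.fderiv_apply ℝ v)
    ((tsupport_fderiv_apply_subset ℝ v).trans hs) hf
  have hlim' := (tendsto_setIntegral_Gui_smul hη.continuous hc hs hf').neg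
  exact tendsto_nhds_unique hlim (hlim'.congr fun n => ((h n).2.2 η hη hc hs).symm)

end MeridianDomain

/-- The space `C_0^∞(Gui(θ))`, encoded by functions on the whole plane as in
`IsLayTestFunction`. -/
def IsGuiTestFunction (θ : ℝ) (w : ℝ × ℝ → ℂ) : Prop :=
  ContDiff ℝ ((⊤ : ℕ∞) : WithTop ℕ∞) w ∧
  ∃ K : Set (ℝ × ℝ), IsCompact K ∧ K ⊆ Gui θ ∧ ∀ p, p ∉ K → w p = 0

/-- The components `∂_r w`, `∂_z w`, `(ω / r) w`, whose squared `L²` norms add up to the form of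
the axisymmetric fiber. -/
def fiberGradient (ω : ℝ) (w : ℝ × ℝ → ℂ) : Fin 3 → ℝ × ℝ → ℂ :=
  ![fun p => fderiv ℝ w p (1, 0), fun p => fderiv ℝ w p (0, 1),
    fun p => ((ω * p.1⁻¹ : ℝ) : ℂ) * w p]

/-- The components `∂_r u`, `∂_z u`, `(ω u - i ∂_φ u) / r` of the magnetic gradient on the layer,
with the sign of the last one chosen so that averaging over the circle maps them to the components
of `fiberGradient`. -/
def magneticGradient (ω : ℝ) (u : (ℝ × ℝ) × ℝ → ℂ) : Fin 3 → (ℝ × ℝ) × ℝ → ℂ :=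
  ![fun x => fderiv ℝ u x ((1, 0), 0), fun x => fderiv ℝ u x ((0, 1), 0),
    fun x => ((x.1.1⁻¹ : ℝ) : ℂ) * ((ω : ℂ) * u x - Complex.I * fderiv ℝ u x ((0, 0), 1))]

/-- The form of the axisymmetric fiber on `C_0^∞(Gui(θ))`. -/
def fiberForm₀ (ω θ : ℝ) (w : ℝ × ℝ → ℂ) : ℝ :=
  ∑ i, (eLpNorm (fiberGradient ω w i) 2 (guiMeasure θ)).toReal ^ 2

/-- The uniform measure of mass `2π` on the circle, parametrized as in `layMeasure`. -/
abbrev angleMeasure : Measure ℝ := volume.restrict (Set.Ioc 0 (2 * Real.pi))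

theorem ae_angleMeasure_mem_Icc : ∀ᵐ φ ∂angleMeasure, φ ∈ Set.Icc 0 (2 * Real.pi) :=
  (ae_restrict_mem measurableSet_Ioc).mono fun _ h => Set.Ioc_subset_Icc_self h

instance (θ : ℝ) : IsLocallyFiniteMeasure (layMeasure θ) := by
  unfold layMeasure
  infer_instance

section TestFunction

variable {θ : ℝ} {w w' : ℝ × ℝ → ℂ} {u u' : (ℝ × ℝ) × ℝ → ℂ}

theorem IsGuiTestFunction.sub (hw : IsGuiTestFunction θ w) (hw' : IsGuiTestFunction θ w') :
    IsGuiTestFunction θ fun p => w p - w' p := by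
  obtain ⟨h, K, hK, hKG, h0⟩ := hw
  obtain ⟨h', K', hK', hKG', h0'⟩ := hw'
  refine ⟨h.sub h', K ∪ K', hK.union hK', Set.union_subset hKG hKG', fun p hp => ?_⟩
  rw [Set.mem_union, not_or] at hp
  simp only [h0 p hp.1, h0' p hp.2, sub_zero]

theorem IsLayTestFunction.sub (hu : IsLayTestFunction θ u) (hu' : IsLayTestFunction θ u') :
    IsLayTestFunction θ fun x => u x - u' x := by
  obtain ⟨h, hper, K, hK, hKG, h0⟩ := hu
  obtain ⟨h', hper', K', hK', hKG', h0'⟩ := hu'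
  refine ⟨h.sub h', fun p φ => by simp only [hper, hper'], K ∪ K', hK.union hK',
    Set.union_subset hKG hKG', fun p hp φ => ?_⟩
  rw [Set.mem_union, not_or] at hp
  simp only [h0 p hp.1, h0' p hp.2, sub_zero]

theorem IsGuiTestFunction.differentiable (hw : IsGuiTestFunction θ w) : Differentiable ℝ w :=
  hw.1.differentiable (by simp)

theorem IsLayTestFunction.differentiable (hu : IsLayTestFunction θ u) : Differentiable ℝ u :=
  hu.1.differentiable (by simp)

theorem IsGuiTestFunction.continuous_fderiv_apply (hw : IsGuiTestFunction θ w) (v : ℝ × ℝ) :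
    Continuous fun p => fderiv ℝ w p v :=
  (hw.1.continuous_fderiv (by simp)).clm_apply continuous_const

theorem IsLayTestFunction.continuous_fderiv_apply (hu : IsLayTestFunction θ u)
    (v : (ℝ × ℝ) × ℝ) : Continuous fun x => fderiv ℝ u x v :=
  (hu.1.continuous_fderiv (by simp)).clm_apply continuous_const

theorem IsGuiTestFunction.hasCompactSupport (hw : IsGuiTestFunction θ w) :
    HasCompactSupport w := by
  obtain ⟨-, K, hK, -, h0⟩ := hw
  exact HasCompactSupport.intro hK h0

theorem IsGuiTestFunction.tsupport_subset (hw : IsGuiTestFunction θ w) : tsupport w ⊆ Gui θ := by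
  obtain ⟨-, K, hK, hKG, h0⟩ := hw
  exact (closure_minimal (Function.support_subset_iff'.2 h0) hK.isClosed).trans hKG

theorem IsLayTestFunction.exists_tsupport_subset (hu : IsLayTestFunction θ u) :
    ∃ K, IsCompact K ∧ K ⊆ Gui θ ∧ tsupport u ⊆ Prod.fst ⁻¹' K := by
  obtain ⟨-, -, K, hK, hKG, h0⟩ := hu
  exact ⟨K, hK, hKG, closure_minimal (Function.support_subset_iff'.2 fun x hx => h0 x.1 hx x.2)
    (hK.isClosed.preimage continuous_fst)⟩

theorem tsupport_fiberGradient_subset (ω : ℝ) (w : ℝ × ℝ → ℂ) (i : Fin 3) :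
    tsupport (fiberGradient ω w i) ⊆ tsupport w := by
  fin_cases i
  · exact tsupport_fderiv_apply_subset ℝ _
  · exact tsupport_fderiv_apply_subset ℝ _
  · exact tsupport_mul_subset_right

theorem tsupport_magneticGradient_subset (ω : ℝ) (u : (ℝ × ℝ) × ℝ → ℂ) (i : Fin 3) :
    tsupport (magneticGradient ω u i) ⊆ tsupport u := by
  fin_cases i
  · exact tsupport_fderiv_apply_subset ℝ _
  · exact tsupport_fderiv_apply_subset ℝ _
  · refine closure_minimal (Function.support_subset_iff'.2 fun x hx => ?_) (isClosed_tsupport u)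
    have hu : u x = 0 := image_eq_zero_of_notMem_tsupport hx
    have hu' : fderiv ℝ u x = 0 :=
      image_eq_zero_of_notMem_tsupport fun h => hx (tsupport_fderiv_subset ℝ h)
    simp [magneticGradient, hu, hu']

theorem IsGuiTestFunction.continuous_fiberGradient (hw : IsGuiTestFunction θ w) (ω : ℝ)
    (i : Fin 3) : Continuous (fiberGradient ω w i) := by
  fin_cases i
  · exact hw.continuous_fderiv_apply _
  · exact hw.continuous_fderiv_apply _
  · refine ContinuousOn.continuous_of_tsupport_subset (s := Gui θ) ?_ (isOpen_Gui θ)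
      ((tsupport_fiberGradient_subset ω w 2).trans hw.tsupport_subset)
    exact (Complex.continuous_ofReal.comp_continuousOn (continuousOn_const.mul
      (continuousOn_fst.inv₀ fun p hp => hp.1.ne'))).mul hw.1.continuous.continuousOn

theorem IsLayTestFunction.continuous_magneticGradient (hu : IsLayTestFunction θ u) (ω : ℝ)
    (i : Fin 3) : Continuous (magneticGradient ω u i) := by
  fin_cases i
  · exact hu.continuous_fderiv_apply _
  · exact hu.continuous_fderiv_apply _
  · obtain ⟨K, -, hKG, hs⟩ := hu.exists_tsupport_subset
    refine ContinuousOn.continuous_of_tsupport_subset (s := Prod.fst ⁻¹' Gui θ) ?_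
      ((isOpen_Gui θ).preimage continuous_fst)
      ((tsupport_magneticGradient_subset ω u 2).trans (hs.trans (Set.preimage_mono hKG)))
    refine (Complex.continuous_ofReal.comp_continuousOn ((continuous_fst.comp
      continuous_fst).continuousOn.inv₀ fun x hx => hx.1.ne')).mul ?_
    exact ((continuous_const.mul hu.1.continuous).sub
      (continuous_const.mul (hu.continuous_fderiv_apply _))).continuousOn

theorem IsGuiTestFunction.memLp (hw : IsGuiTestFunction θ w) : MemLp w 2 (guiMeasure θ) :=
  hw.1.continuous.memLp_of_hasCompactSupport hw.hasCompactSupport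

theorem IsGuiTestFunction.memLp_fiberGradient (hw : IsGuiTestFunction θ w) (ω : ℝ) (i : Fin 3) :
    MemLp (fiberGradient ω w i) 2 (guiMeasure θ) :=
  (hw.continuous_fiberGradient ω i).memLp_of_hasCompactSupport
    (hw.hasCompactSupport.mono' (subset_closure.trans (tsupport_fiberGradient_subset ω w i)))

theorem memLp_layMeasure_of_continuous {E : Type*} [NormedAddCommGroup E] {f : (ℝ × ℝ) × ℝ → E}
    {K : Set (ℝ × ℝ)} (hf : Continuous f) (hK : IsCompact K) (hs : tsupport f ⊆ Prod.fst ⁻¹' K) :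
    MemLp f 2 (layMeasure θ) := by
  rw [memLp_two_iff_integrable_sq_norm hf.aestronglyMeasurable]
  have hangle : ∀ᵐ x ∂layMeasure θ, x.2 ∈ Set.Icc 0 (2 * Real.pi) :=
    Measure.quasiMeasurePreserving_snd.ae ae_angleMeasure_mem_Icc
  refine IntegrableOn.integrable_of_ae_notMem_eq_zero (s := K ×ˢ Set.Icc 0 (2 * Real.pi))
    ((hf.norm.pow 2).continuousOn.integrableOn_compact (hK.prod isCompact_Icc)) ?_
  filter_upwards [hangle] with x hx hxK
  rw [image_eq_zero_of_notMem_tsupport fun h => hxK ⟨hs h, hx⟩, norm_zero, zero_pow two_ne_zero]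

theorem IsLayTestFunction.memLp (hu : IsLayTestFunction θ u) : MemLp u 2 (layMeasure θ) := by
  obtain ⟨K, hK, -, hs⟩ := hu.exists_tsupport_subset
  exact memLp_layMeasure_of_continuous hu.1.continuous hK hs

theorem IsLayTestFunction.memLp_magneticGradient (hu : IsLayTestFunction θ u) (ω : ℝ)
    (i : Fin 3) : MemLp (magneticGradient ω u i) 2 (layMeasure θ) := by
  obtain ⟨K, hK, -, hs⟩ := hu.exists_tsupport_subset
  exact memLp_layMeasure_of_continuous (hu.continuous_magneticGradient ω i) hK
    ((tsupport_magneticGradient_subset ω u i).trans hs)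

theorem fiberGradient_sub (hw : Differentiable ℝ w) (hw' : Differentiable ℝ w') (ω : ℝ)
    (i : Fin 3) :
    fiberGradient ω (fun p => w p - w' p) i = fiberGradient ω w i - fiberGradient ω w' i := by
  ext p
  fin_cases i <;> simp [fiberGradient, fderiv_fun_sub (hw p) (hw' p), mul_sub]

theorem IsLayTestFunction.layForm₀_eq_sum (hu : IsLayTestFunction θ u) (ω : ℝ) :
    layForm₀ ω θ u =
      ∑ i, (eLpNorm (magneticGradient ω u i) 2 (layMeasure θ)).toReal ^ 2 := by
  simp only [← integral_norm_sq_eq_sq_eLpNorm (hu.memLp_magneticGradient ω _)]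
  rw [← integral_finsetSum _ fun i _ =>
    (hu.memLp_magneticGradient ω i).integrable_norm_pow two_ne_zero, layForm₀]
  refine integral_congr_ae (Eventually.of_forall fun x => ?_)
  simp only [Fin.sum_univ_three, magneticGradient, Matrix.cons_val, norm_mul, Complex.norm_real,
    mul_pow, norm_inv, inv_pow, Real.norm_eq_abs, sq_abs]
  rw [norm_sub_rev, div_eq_inv_mul]

end TestFunction

section Averaging

variable {θ : ℝ} {w : ℝ × ℝ → ℂ} {u u' : (ℝ × ℝ) × ℝ → ℂ}

theorem integrable_angleMeasure {f : ℝ → ℂ} (hf : Continuous f) : Integrable f angleMeasure :=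
  integrable_of_continuous_of_ae_mem_isCompact isCompact_Icc ae_angleMeasure_mem_Icc hf

theorem angleMeasure_univ_mul_enorm_sq :
    angleMeasure Set.univ * ‖((1 / Real.sqrt (2 * Real.pi) : ℝ) : ℂ)‖ₑ ^ 2 = 1 := by
  have hpi : 0 < 2 * Real.pi := Real.two_pi_pos
  rw [Measure.restrict_apply_univ, Real.volume_Ioc, sub_zero, ← ofReal_norm,
    ← ENNReal.ofReal_pow (norm_nonneg _), Complex.norm_real, Real.norm_eq_abs, sq_abs, div_pow,
    Real.sq_sqrt hpi.le, one_pow, ← ENNReal.ofReal_mul hpi.le, mul_one_div_cancel hpi.ne',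
    ENNReal.ofReal_one]

theorem eLpNorm_axisymmetricProj_le (hu : AEStronglyMeasurable u (layMeasure θ)) :
    eLpNorm (axisymmetricProj u) 2 (guiMeasure θ) ≤ eLpNorm u 2 (layMeasure θ) := by
  rw [layMeasure] at hu ⊢
  rw [← ENNReal.pow_le_pow_left_iff two_ne_zero, eLpNorm_two_sq, eLpNorm_two_sq,
    lintegral_prod _ (by fun_prop)]
  refine lintegral_mono_ae ?_
  filter_upwards [hu.prodMk_left] with p hp
  refine (enorm_integral_sq_le (hp.mul_const _)).trans_eq ?_
  simp only [enorm_mul, mul_pow]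
  rw [lintegral_mul_const'' _ (hp.enorm.pow_const 2), mul_left_comm, angleMeasure_univ_mul_enorm_sq,
    mul_one]

theorem axisymmetricProj_sub {p : ℝ × ℝ} (hu : Integrable (fun φ => u (p, φ)) angleMeasure)
    (hu' : Integrable (fun φ => u' (p, φ)) angleMeasure) :
    axisymmetricProj (fun x => u x - u' x) p = axisymmetricProj u p - axisymmetricProj u' p := by
  simp only [axisymmetricProj, sub_mul]
  exact integral_sub (hu.mul_const _) (hu'.mul_const _)

theorem ae_integrable_angleMeasure (hu : MemLp u 2 (layMeasure θ)) :
    ∀ᵐ p ∂guiMeasure θ, Integrable (fun φ => u (p, φ)) angleMeasure := by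
  have hsq := hu.integrable_norm_pow two_ne_zero
  have hmeas := hu.1
  rw [layMeasure] at hsq hmeas
  filter_upwards [hsq.prod_right_ae, hmeas.prodMk_left] with p hp hp'
  exact ((memLp_two_iff_integrable_sq_norm hp').2 hp).integrable one_le_two

theorem IsLayTestFunction.integrable_angleMeasure (hu : IsLayTestFunction θ u) (p : ℝ × ℝ) :
    Integrable (fun φ => u (p, φ)) angleMeasure :=
  ConicalLayer.integrable_angleMeasure (hu.1.continuous.comp (Continuous.prodMk_right p))

theorem IsLayTestFunction.axisymmetricProj (hu : IsLayTestFunction θ u) :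
    IsGuiTestFunction θ (axisymmetricProj u) := by
  obtain ⟨hsmooth, -, K, hK, hKG, h0⟩ := hu
  refine ⟨contDiff_integral_of_isCompact isCompact_Icc ae_angleMeasure_mem_Icc
    (hsmooth.mul contDiff_const), K, hK, hKG, fun p hp => ?_⟩
  simp only [ConicalLayer.axisymmetricProj, h0 p hp, zero_mul, integral_zero]

theorem fderiv_axisymmetricProj (hu : ContDiff ℝ 1 u) (p v : ℝ × ℝ) :
    fderiv ℝ (axisymmetricProj u) p v = axisymmetricProj (fun x => fderiv ℝ u x (v, 0)) p := by
  have hsmooth : ContDiff ℝ 1 fun x => u x * ((1 / Real.sqrt (2 * Real.pi) : ℝ) : ℂ) :=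
    hu.mul contDiff_const
  have hderiv := hasFDerivAt_integral_of_isCompact isCompact_Icc ae_angleMeasure_mem_Icc hsmooth p
  have hint := integrable_of_continuous_of_ae_mem_isCompact isCompact_Icc ae_angleMeasure_mem_Icc
    (((hsmooth.continuous_fderiv one_ne_zero).comp (Continuous.prodMk_right p)).clm_comp
      (continuous_const (y := ContinuousLinearMap.inl ℝ (ℝ × ℝ) ℝ)))
  refine (congrArg (· v) hderiv.fderiv).trans ((ContinuousLinearMap.integral_apply hint v).trans ?_)
  refine integral_congr_ae (Eventually.of_forall fun φ => ?_)
  simp [fderiv_mul_const (hu.differentiable one_ne_zero (p, φ)), mul_comm]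

theorem IsLayTestFunction.integral_fderiv_angle (hu : IsLayTestFunction θ u) (p : ℝ × ℝ) :
    ∫ φ, fderiv ℝ u (p, φ) ((0, 0), 1) ∂angleMeasure = 0 := by
  have hderiv : ∀ φ, HasDerivAt (fun φ => u (p, φ)) (fderiv ℝ u (p, φ) ((0, 0), 1)) φ := fun φ =>
    (hu.differentiable (p, φ)).hasFDerivAt.comp_hasDerivAt φ
      ((hasDerivAt_const φ p).prodMk (hasDerivAt_id φ))
  have hcont : Continuous fun φ => fderiv ℝ u (p, φ) ((0, 0), 1) :=
    (hu.continuous_fderiv_apply _).comp (Continuous.prodMk_right p)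
  rw [← intervalIntegral.integral_of_le Real.two_pi_pos.le,
    intervalIntegral.integral_eq_sub_of_hasDerivAt (fun φ _ => hderiv φ)
      (hcont.intervalIntegrable _ _), sub_eq_zero, ← hu.2.1 p 0, zero_add]

theorem IsLayTestFunction.fiberGradient_axisymmetricProj (hu : IsLayTestFunction θ u) (ω : ℝ)
    (i : Fin 3) : fiberGradient ω (ConicalLayer.axisymmetricProj u) i =
      ConicalLayer.axisymmetricProj (magneticGradient ω u i) := by
  have hC1 : ContDiff ℝ 1 u := hu.1.of_le (by exact_mod_cast le_top)
  ext p
  fin_cases i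
  · exact fderiv_axisymmetricProj hC1 p _
  · exact fderiv_axisymmetricProj hC1 p _
  · have hint' : Integrable (fun φ => fderiv ℝ u (p, φ) ((0, 0), 1)) angleMeasure :=
      ConicalLayer.integrable_angleMeasure
        ((hu.continuous_fderiv_apply _).comp (Continuous.prodMk_right p))
    simp only [ConicalLayer.axisymmetricProj, fiberGradient, magneticGradient, Fin.reduceFinMk,
      Matrix.cons_val]
    rw [integral_mul_const, integral_mul_const, integral_const_mul,
      integral_sub ((hu.integrable_angleMeasure p).const_mul _) (hint'.const_mul _),
      integral_const_mul, integral_const_mul, hu.integral_fderiv_angle]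
    push_cast
    ring

theorem IsLayTestFunction.fiberForm₀_axisymmetricProj_le (hu : IsLayTestFunction θ u) (ω : ℝ) :
    fiberForm₀ ω θ (ConicalLayer.axisymmetricProj u) ≤ layForm₀ ω θ u := by
  rw [hu.layForm₀_eq_sum, fiberForm₀]
  gcongr with i
  · exact (hu.memLp_magneticGradient ω i).2.ne
  · rw [hu.fiberGradient_axisymmetricProj]
    exact eLpNorm_axisymmetricProj_le (hu.memLp_magneticGradient ω i).1

/-- The extension of a function on the meridian domain to an axisymmetric function on the layer,
normalized so that it is an isometric right inverse of `axisymmetricProj`. -/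
def axisymmetricExt (w : ℝ × ℝ → ℂ) (x : (ℝ × ℝ) × ℝ) : ℂ :=
  ((1 / Real.sqrt (2 * Real.pi) : ℝ) : ℂ) * w x.1

theorem axisymmetricExt_sub (w w' : ℝ × ℝ → ℂ) :
    axisymmetricExt (fun p => w p - w' p) = fun x => axisymmetricExt w x - axisymmetricExt w' x :=
  funext fun _ => mul_sub _ _ _

theorem eLpNorm_axisymmetricExt (hw : AEStronglyMeasurable w (guiMeasure θ)) :
    eLpNorm (axisymmetricExt w) 2 (layMeasure θ) = eLpNorm w 2 (guiMeasure θ) := by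
  have hmeas : AEStronglyMeasurable (axisymmetricExt w) ((guiMeasure θ).prod angleMeasure) :=
    hw.comp_fst.const_mul _
  rw [← (ENNReal.pow_right_strictMono two_ne_zero).injective.eq_iff, eLpNorm_two_sq,
    eLpNorm_two_sq, layMeasure, lintegral_prod _ (by fun_prop)]
  refine lintegral_congr fun p => ?_
  simp only [axisymmetricExt, enorm_mul, mul_pow]
  rw [lintegral_const, mul_right_comm, mul_comm (_ ^ 2), angleMeasure_univ_mul_enorm_sq, one_mul]

theorem axisymmetricProj_axisymmetricExt (w : ℝ × ℝ → ℂ) :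
    axisymmetricProj (axisymmetricExt w) = w := by
  have hpi : ((2 * Real.pi : ℝ) : ℂ) ≠ 0 := Complex.ofReal_ne_zero.2 Real.two_pi_pos.ne'
  have hc : ((1 / Real.sqrt (2 * Real.pi) : ℝ) : ℂ) * ((1 / Real.sqrt (2 * Real.pi) : ℝ) : ℂ) =
      ((2 * Real.pi : ℝ) : ℂ)⁻¹ := by
    rw [← Complex.ofReal_mul, ← sq, div_pow, Real.sq_sqrt Real.two_pi_pos.le, one_pow, one_div,
      Complex.ofReal_inv]
  ext p
  simp only [axisymmetricProj, axisymmetricExt]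
  rw [setIntegral_const, Real.volume_real_Ioc_of_le Real.two_pi_pos.le, sub_zero,
    Complex.real_smul, mul_right_comm, hc, mul_inv_cancel_left₀ hpi]

theorem IsGuiTestFunction.axisymmetricExt (hw : IsGuiTestFunction θ w) :
    IsLayTestFunction θ (axisymmetricExt w) := by
  obtain ⟨hsmooth, K, hK, hKG, h0⟩ := hw
  exact ⟨contDiff_const.mul (hsmooth.comp contDiff_fst), fun _ _ => rfl, K, hK, hKG,
    fun p hp _ => mul_eq_zero_of_right _ (h0 p hp)⟩

theorem magneticGradient_axisymmetricExt (hw : Differentiable ℝ w) (ω : ℝ) (i : Fin 3) :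
    magneticGradient ω (axisymmetricExt w) i = axisymmetricExt (fiberGradient ω w i) := by
  have hderiv : ∀ x v, fderiv ℝ (axisymmetricExt w) x v =
      ((1 / Real.sqrt (2 * Real.pi) : ℝ) : ℂ) * fderiv ℝ w x.1 v.1 := fun x v =>
    congrArg (· v)
      (((hw x.1).hasFDerivAt.comp x hasFDerivAt_fst).const_mul
        ((1 / Real.sqrt (2 * Real.pi) : ℝ) : ℂ)).fderiv
  ext x
  fin_cases i
  · exact hderiv x _
  · exact hderiv x _
  · simp only [magneticGradient, fiberGradient, axisymmetricExt, hderiv, Fin.reduceFinMk,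
      Matrix.cons_val]
    rw [show fderiv ℝ w x.1 (0, 0) = 0 from map_zero _]
    push_cast
    ring

theorem IsGuiTestFunction.layForm₀_axisymmetricExt (hw : IsGuiTestFunction θ w) (ω : ℝ) :
    layForm₀ ω θ (ConicalLayer.axisymmetricExt w) = fiberForm₀ ω θ w := by
  simp only [hw.axisymmetricExt.layForm₀_eq_sum, fiberForm₀,
    magneticGradient_axisymmetricExt hw.differentiable,
    eLpNorm_axisymmetricExt (hw.memLp_fiberGradient ω _).1]

end Averaging

/-- `w` is a sequence in `C_0^∞(Gui(θ))` that converges to `g` in `L²` and is Cauchy for the form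
of the axisymmetric fiber, as in the definition of `layFormDomain`. -/
structure IsFormApprox (ω θ : ℝ) (w : ℕ → ℝ × ℝ → ℂ) (g : ℝ × ℝ → ℂ) : Prop where
  test : ∀ n, IsGuiTestFunction θ (w n)
  tendsto : Tendsto (fun n => eLpNorm (fun p => w n p - g p) 2 (guiMeasure θ)) atTop (𝓝 0)
  cauchy : Tendsto (fun m : ℕ × ℕ => fiberForm₀ ω θ fun p => w m.1 p - w m.2 p) atTop (𝓝 0)

section FormClosure

variable {ω θ : ℝ} {w : ℕ → ℝ × ℝ → ℂ} {g : L2Gui θ}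

theorem IsFormApprox.congr {f f' : ℝ × ℝ → ℂ} (h : IsFormApprox ω θ w f)
    (hf : f =ᵐ[guiMeasure θ] f') : IsFormApprox ω θ w f' := by
  refine ⟨h.test, h.tendsto.congr fun n => eLpNorm_congr_ae ?_, h.cauchy⟩
  filter_upwards [hf] with p hp
  rw [hp]

theorem exists_isFormApprox_of_mem_fiberDomain (hg : g ∈ fiberDomain ω θ) :
    ∃ w, IsFormApprox ω θ w g := by
  obtain ⟨u, ⟨w, hw, hlim, hcauchy⟩, hgu⟩ := hg
  have hdiff : ∀ n, MemLp (fun x => w n x - u x) 2 (layMeasure θ) := fun n =>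
    (hw n).memLp.sub (Lp.memLp u)
  have hproj : ∀ n, (fun p => axisymmetricProj (w n) p - g p) =ᵐ[guiMeasure θ]
      axisymmetricProj fun x => w n x - u x := fun n => by
    filter_upwards [hgu, ae_integrable_angleMeasure (Lp.memLp u)] with p hp hint
    rw [hp, axisymmetricProj_sub ((hw n).integrable_angleMeasure p) hint]
  refine ⟨fun n => axisymmetricProj (w n), fun n => (hw n).axisymmetricProj,
    tendsto_of_tendsto_of_tendsto_of_le_of_le tendsto_const_nhds hlim (fun _ => zero_le)
      fun n => ?_,
    squeeze_zero (fun _ => Finset.sum_nonneg fun _ _ => by positivity) (fun m => ?_) hcauchy⟩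
  · exact (eLpNorm_congr_ae (hproj n)).trans_le (eLpNorm_axisymmetricProj_le (hdiff n).1)
  · simp only [← axisymmetricProj_sub ((hw m.1).integrable_angleMeasure _)
      ((hw m.2).integrable_angleMeasure _)]
    exact ((hw m.1).sub (hw m.2)).fiberForm₀_axisymmetricProj_le ω

theorem IsFormApprox.mem_fiberDomain (h : IsFormApprox ω θ w g) : g ∈ fiberDomain ω θ := by
  have hg : AEStronglyMeasurable g (guiMeasure θ) := (Lp.memLp g).1
  have hmem : MemLp (axisymmetricExt g) 2 (layMeasure θ) :=
    ⟨hg.comp_fst.const_mul _, (eLpNorm_axisymmetricExt hg).trans_lt (Lp.memLp g).2⟩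
  refine ⟨hmem.toLp, ⟨fun n => axisymmetricExt (w n), fun n => (h.test n).axisymmetricExt,
    h.tendsto.congr fun n => ?_, h.cauchy.congr fun m => ?_⟩, ?_⟩
  · have hmeas : AEStronglyMeasurable (fun p => w n p - g p) (guiMeasure θ) :=
      (h.test n).memLp.1.sub hg
    rw [← eLpNorm_axisymmetricExt hmeas, axisymmetricExt_sub]
    refine eLpNorm_congr_ae ?_
    filter_upwards [hmem.coeFn_toLp] with x hx
    rw [hx]
  · rw [← axisymmetricExt_sub, ((h.test m.1).sub (h.test m.2)).layForm₀_axisymmetricExt]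
  · filter_upwards [Measure.ae_ae_of_ae_prod (hmem.coeFn_toLp : _ =ᵐ[(guiMeasure θ).prod _] _)]
      with p hp
    rw [← congrFun (axisymmetricProj_axisymmetricExt g) p]
    refine integral_congr_ae ?_
    filter_upwards [hp] with φ hφ
    rw [hφ]

theorem mem_fiberDomain_iff : g ∈ fiberDomain ω θ ↔ ∃ w, IsFormApprox ω θ w g :=
  ⟨exists_isFormApprox_of_mem_fiberDomain, fun ⟨_, h⟩ => h.mem_fiberDomain⟩

theorem IsGuiTestFunction.fiberForm₀_eq_sum_norm_toLp {w : ℝ × ℝ → ℂ}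
    (hw : IsGuiTestFunction θ w) (ω : ℝ) :
    fiberForm₀ ω θ w = ∑ i, ‖(hw.memLp_fiberGradient ω i).toLp‖ ^ 2 := by
  simp only [Lp.norm_toLp, fiberForm₀]

theorem IsFormApprox.cauchySeq_fiberGradient {f : ℝ × ℝ → ℂ} (h : IsFormApprox ω θ w f)
    (i : Fin 3) : CauchySeq fun n => ((h.test n).memLp_fiberGradient ω i).toLp := by
  refine cauchySeq_iff_tendsto_dist_atTop_0.2 ?_
  refine squeeze_zero (fun _ => dist_nonneg) (fun m => Real.le_sqrt_of_sq_le ?_)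
    (Real.sqrt_zero ▸ h.cauchy.sqrt)
  rw [dist_eq_norm, ← MemLp.toLp_sub, Lp.norm_toLp,
    ← fiberGradient_sub (h.test m.1).differentiable (h.test m.2).differentiable]
  exact Finset.single_le_sum (f := fun i =>
    (eLpNorm (fiberGradient ω (fun p => w m.1 p - w m.2 p) i) 2 (guiMeasure θ)).toReal ^ 2)
    (fun _ _ => sq_nonneg _) (Finset.mem_univ i)

theorem IsFormApprox.tendsto_toLp (h : IsFormApprox ω θ w g) :
    Tendsto (fun n => (h.test n).memLp.toLp) atTop (𝓝 g) := by
  simpa only [Lp.toLp_coeFn] using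
    (Lp.tendsto_Lp_iff_tendsto_eLpNorm'' w (fun n => (h.test n).memLp) g (Lp.memLp g)).2 h.tendsto

theorem IsFormApprox.weakDeriv_ae_eq (h : IsFormApprox ω θ w g) {v : ℝ × ℝ} {f : ℕ → L2Gui θ}
    {g' : L2Gui θ} (hf : ∀ n, f n =ᵐ[guiMeasure θ] fun p => fderiv ℝ (w n) p v)
    (hg' : Tendsto f atTop (𝓝 g')) : weakDeriv (Gui θ) g v =ᵐ[guiMeasure θ] g' := by
  have hac := restrict_Gui_absolutelyContinuous_guiMeasure θ
  have hweak : ∀ n, IsWeakDeriv (Gui θ) (h.test n).memLp.toLp (f n) v := fun n =>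
    (isWeakDeriv_fderiv ((h.test n).1.of_le (by exact_mod_cast le_top)) (Gui θ) v).congr
      (hac.ae_eq (h.test n).memLp.coeFn_toLp.symm) (hac.ae_eq (hf n).symm)
  exact (guiMeasure_absolutelyContinuous_restrict_Gui θ).ae_eq
    ((IsWeakDeriv.of_tendsto hweak h.tendsto_toLp hg').weakDeriv_ae_eq (isOpen_Gui θ))

theorem IsFormApprox.fiberForm_eq_sum (h : IsFormApprox ω θ w g) {G : Fin 3 → L2Gui θ}
    (hG : ∀ i, Tendsto (fun n => ((h.test n).memLp_fiberGradient ω i).toLp) atTop (𝓝 (G i))) :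
    fiberForm ω θ g = ∑ i, ‖G i‖ ^ 2 := by
  have hgrad : ∀ n i, ((h.test n).memLp_fiberGradient ω i).toLp =ᵐ[guiMeasure θ]
      fiberGradient ω (w n) i := fun n i => MemLp.coeFn_toLp _
  have hr := h.weakDeriv_ae_eq (fun n => hgrad n 0) (hG 0)
  have hz := h.weakDeriv_ae_eq (fun n => hgrad n 1) (hG 1)
  have hpot : G 2 =ᵐ[guiMeasure θ] fun p => ((ω * p.1⁻¹ : ℝ) : ℂ) * g p := by
    refine ae_eq_mul_of_tendsto_Lp (fun n => ?_) h.tendsto_toLp (hG 2)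
    filter_upwards [hgrad n 2, (h.test n).memLp.coeFn_toLp] with p hp hp'
    rw [hp, hp']
    rfl
  simp only [Lp.norm_def, ← integral_norm_sq_eq_sq_eLpNorm (Lp.memLp (G _))]
  rw [← integral_finsetSum _ fun i _ => (Lp.memLp (G i)).integrable_norm_pow two_ne_zero]
  refine integral_congr_ae ?_
  filter_upwards [hr, hz, hpot] with p hp₀ hp₁ hp₂
  rw [Fin.sum_univ_three, hp₀, hp₁, hp₂, norm_mul, Complex.norm_real, mul_pow, Real.norm_eq_abs,
    sq_abs, mul_pow, inv_pow, div_eq_mul_inv]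

theorem IsFormApprox.tendsto_fiberForm₀ (h : IsFormApprox ω θ w g) :
    Tendsto (fun n => fiberForm₀ ω θ (w n)) atTop (𝓝 (fiberForm ω θ g)) := by
  choose G hG using fun i => cauchySeq_tendsto_of_complete (h.cauchySeq_fiberGradient i)
  rw [h.fiberForm_eq_sum hG]
  simp only [fun n => (h.test n).fiberForm₀_eq_sum_norm_toLp ω]
  exact tendsto_finsetSum _ fun i _ => (hG i).norm.pow 2

end FormClosure

/-- The unit normal of the parallel sides of `Gui(θ)`, in the coordinates `(r, z)`. -/
def sideNormal (θ : ℝ) : ℝ × ℝ := (Real.cos θ, -Real.sin θ)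

/-- The unit vector that directs the parallel sides of `Gui(θ)`, in the coordinates `(r, z)`. -/
def sideTangent (θ : ℝ) : ℝ × ℝ := (Real.sin θ, Real.cos θ)

/-- The linear map sending `Gui(θ)` onto `Gui(θ')` that preserves the distance
`r cos θ - z sin θ` to the lower side and multiplies the coordinate `r sin θ + z cos θ` along the
sides by `tan θ / tan θ'`. -/
def stretch (θ θ' : ℝ) : ℝ × ℝ →L[ℝ] ℝ × ℝ :=
  (Real.cos θ • ContinuousLinearMap.fst ℝ ℝ ℝ -
      Real.sin θ • ContinuousLinearMap.snd ℝ ℝ ℝ).smulRight (sideNormal θ') +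
    (Real.tan θ / Real.tan θ') • (Real.sin θ • ContinuousLinearMap.fst ℝ ℝ ℝ +
      Real.cos θ • ContinuousLinearMap.snd ℝ ℝ ℝ).smulRight (sideTangent θ')

section Geometry

theorem stretch_apply (θ θ' : ℝ) (p : ℝ × ℝ) :
    stretch θ θ' p = (p.1 * Real.cos θ - p.2 * Real.sin θ) • sideNormal θ' +
      (Real.tan θ / Real.tan θ' * (p.1 * Real.sin θ + p.2 * Real.cos θ)) • sideTangent θ' := by
  simp [stretch, smul_smul, mul_comm (Real.cos θ), mul_comm (Real.sin θ)]

/-- The factor by which `stretch θ θ'` changes the measure `r dr dz`. -/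
def stretchFactor (θ θ' : ℝ) : ℝ :=
  Real.cos θ / Real.cos θ' * |(LinearMap.det (stretch θ θ' : ℝ × ℝ →ₗ[ℝ] ℝ × ℝ))⁻¹|

theorem stretch_sideNormal (θ θ' : ℝ) : stretch θ θ' (sideNormal θ) = sideNormal θ' := by
  have hdist : Real.cos θ * Real.cos θ - -Real.sin θ * Real.sin θ = 1 := by
    linear_combination Real.sin_sq_add_cos_sq θ
  have hside : Real.cos θ * Real.sin θ + -Real.sin θ * Real.cos θ = 0 := by ring
  rw [stretch_apply, sideNormal, hdist, hside, one_smul, mul_zero, zero_smul, add_zero]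

theorem stretch_sideTangent (θ θ' : ℝ) :
    stretch θ θ' (sideTangent θ) = (Real.tan θ / Real.tan θ') • sideTangent θ' := by
  have hdist : Real.sin θ * Real.cos θ - Real.cos θ * Real.sin θ = 0 := by ring
  have hside : Real.sin θ * Real.sin θ + Real.cos θ * Real.cos θ = 1 := by
    linear_combination Real.sin_sq_add_cos_sq θ
  rw [stretch_apply, sideTangent, hdist, hside, zero_smul, mul_one, zero_add]

theorem sq_norm_add_sq_norm_eq_side {F : Type*} [NormedAddCommGroup F] [InnerProductSpace ℝ F]
    (T : ℝ × ℝ →L[ℝ] F) (θ : ℝ) :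
    ‖T (1, 0)‖ ^ 2 + ‖T (0, 1)‖ ^ 2 = ‖T (sideNormal θ)‖ ^ 2 + ‖T (sideTangent θ)‖ ^ 2 := by
  have hT : ∀ a b : ℝ, T (a, b) = a • T (1, 0) + b • T (0, 1) := fun a b => by
    rw [← map_smul, ← map_smul, ← map_add]
    simp
  rw [sideNormal, sideTangent, hT (Real.cos θ), hT (Real.sin θ), norm_add_sq_real,
    norm_add_sq_real]
  simp only [norm_smul, real_inner_smul_left, real_inner_smul_right, mul_pow, norm_neg,
    Real.norm_eq_abs, sq_abs]
  linear_combination (-(‖T (1, 0)‖ ^ 2 + ‖T (0, 1)‖ ^ 2)) * Real.sin_sq_add_cos_sq θ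

variable {θ θ' : ℝ}

theorem cos_pos_of_mem_Ioo_zero (hθ : θ ∈ Set.Ioo 0 (Real.pi / 2)) : 0 < Real.cos θ :=
  Real.cos_pos_of_mem_Ioo ⟨by linarith [hθ.1, Real.pi_pos], hθ.2⟩

theorem sin_pos_of_mem_Ioo_zero (hθ : θ ∈ Set.Ioo 0 (Real.pi / 2)) : 0 < Real.sin θ :=
  Real.sin_pos_of_pos_of_lt_pi hθ.1 (by linarith [hθ.2, Real.pi_pos])

theorem mem_Gui_iff (hθ : θ ∈ Set.Ioo 0 (Real.pi / 2)) {p : ℝ × ℝ} :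
    p ∈ Gui θ ↔ 0 < p.1 ∧ p.1 * Real.cos θ - p.2 * Real.sin θ ∈ Set.Ioo 0 Real.pi := by
  have hc := cos_pos_of_mem_Ioo_zero hθ
  have hs := sin_pos_of_mem_Ioo_zero hθ
  have hlower : p.2 * Real.tan θ < p.1 ↔ 0 < p.1 * Real.cos θ - p.2 * Real.sin θ := by
    rw [Real.tan_eq_sin_div_cos, ← mul_div_assoc, div_lt_iff₀ hc, sub_pos]
  have hupper : p.1 < p.2 * Real.tan θ + Real.pi / Real.cos θ ↔
      p.1 * Real.cos θ - p.2 * Real.sin θ < Real.pi := by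
    rw [Real.tan_eq_sin_div_cos, ← mul_div_assoc, ← add_div, lt_div_iff₀ hc, sub_lt_iff_lt_add']
  rw [Gui, Set.mem_ofPred_eq, max_lt_iff, hlower, hupper]
  refine ⟨fun h => ⟨h.1, h.2.2.1.2, h.2.2.2⟩, fun h => ⟨h.1, ?_, ⟨h.1, h.2.1⟩, h.2.2⟩⟩
  rw [neg_lt, lt_div_iff₀ hs]
  linarith [mul_pos h.1 hc, h.2.2]

theorem stretch_fst (hθ : θ ∈ Set.Ioo 0 (Real.pi / 2)) (hθ' : θ' ∈ Set.Ioo 0 (Real.pi / 2))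
    (p : ℝ × ℝ) : (stretch θ θ' p).1 = Real.cos θ' / Real.cos θ * p.1 := by
  have hc := (cos_pos_of_mem_Ioo_zero hθ).ne'
  have hs' := (sin_pos_of_mem_Ioo_zero hθ').ne'
  simp only [stretch_apply, sideNormal, sideTangent, Prod.fst_add, Prod.smul_fst, smul_eq_mul,
    Real.tan_eq_sin_div_cos]
  field_simp
  linear_combination p.1 * Real.cos θ' * Real.sin_sq_add_cos_sq θ

theorem dist_side_stretch (θ θ' : ℝ) (p : ℝ × ℝ) :
    (stretch θ θ' p).1 * Real.cos θ' - (stretch θ θ' p).2 * Real.sin θ' =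
      p.1 * Real.cos θ - p.2 * Real.sin θ := by
  simp only [stretch_apply, sideNormal, sideTangent, Prod.fst_add, Prod.snd_add, Prod.smul_fst,
    Prod.smul_snd, smul_eq_mul]
  linear_combination (p.1 * Real.cos θ - p.2 * Real.sin θ) * Real.sin_sq_add_cos_sq θ'

theorem stretch_mem_Gui_iff (hθ : θ ∈ Set.Ioo 0 (Real.pi / 2))
    (hθ' : θ' ∈ Set.Ioo 0 (Real.pi / 2)) {p : ℝ × ℝ} :
    stretch θ θ' p ∈ Gui θ' ↔ p ∈ Gui θ := by
  have hscale := div_pos (cos_pos_of_mem_Ioo_zero hθ') (cos_pos_of_mem_Ioo_zero hθ)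
  rw [mem_Gui_iff hθ', mem_Gui_iff hθ, dist_side_stretch, stretch_fst hθ hθ',
    mul_pos_iff_of_pos_left hscale]

theorem leftInverse_stretch (hθ : θ ∈ Set.Ioo 0 (Real.pi / 2))
    (hθ' : θ' ∈ Set.Ioo 0 (Real.pi / 2)) :
    Function.LeftInverse (stretch θ' θ) (stretch θ θ') := fun p => by
  have ht := (Real.tan_pos_of_pos_of_lt_pi_div_two hθ.1 hθ.2).ne'
  have ht' := (Real.tan_pos_of_pos_of_lt_pi_div_two hθ'.1 hθ'.2).ne'
  rw [stretch_apply θ θ' p, map_add, map_smul, map_smul, stretch_sideNormal, stretch_sideTangent,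
    smul_smul, mul_right_comm, div_mul_div_cancel₀ ht', div_self ht, one_mul]
  ext
  · simp only [sideNormal, sideTangent, Prod.fst_add, Prod.smul_fst, smul_eq_mul]
    linear_combination p.1 * Real.sin_sq_add_cos_sq θ
  · simp only [sideNormal, sideTangent, Prod.snd_add, Prod.smul_snd, smul_eq_mul]
    linear_combination p.2 * Real.sin_sq_add_cos_sq θ

end Geometry

section ChangeOfVariables

variable {θ θ' : ℝ}

theorem measurableEmbedding_stretch (hθ : θ ∈ Set.Ioo 0 (Real.pi / 2))
    (hθ' : θ' ∈ Set.Ioo 0 (Real.pi / 2)) : MeasurableEmbedding (stretch θ θ') :=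
  (ContinuousLinearEquiv.equivOfInverse (stretch θ θ') (stretch θ' θ)
    (leftInverse_stretch hθ hθ') (leftInverse_stretch hθ' hθ)).toHomeomorph.measurableEmbedding

theorem det_stretch_ne_zero (hθ : θ ∈ Set.Ioo 0 (Real.pi / 2))
    (hθ' : θ' ∈ Set.Ioo 0 (Real.pi / 2)) :
    LinearMap.det (stretch θ θ' : ℝ × ℝ →ₗ[ℝ] ℝ × ℝ) ≠ 0 :=
  (ContinuousLinearEquiv.equivOfInverse (stretch θ θ') (stretch θ' θ)
    (leftInverse_stretch hθ hθ')
    (leftInverse_stretch hθ' hθ)).toLinearEquiv.isUnit_det'.ne_zero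

theorem stretchFactor_pos (hθ : θ ∈ Set.Ioo 0 (Real.pi / 2))
    (hθ' : θ' ∈ Set.Ioo 0 (Real.pi / 2)) : 0 < stretchFactor θ θ' :=
  mul_pos (div_pos (cos_pos_of_mem_Ioo_zero hθ) (cos_pos_of_mem_Ioo_zero hθ'))
    (abs_pos.2 (inv_ne_zero (det_stretch_ne_zero hθ hθ')))

theorem map_stretch_guiMeasure (hθ : θ ∈ Set.Ioo 0 (Real.pi / 2))
    (hθ' : θ' ∈ Set.Ioo 0 (Real.pi / 2)) :
    (guiMeasure θ).map (stretch θ θ') = ENNReal.ofReal (stretchFactor θ θ') • guiMeasure θ' := by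
  have hme := measurableEmbedding_stretch hθ hθ'
  have hscale : 0 < Real.cos θ / Real.cos θ' :=
    div_pos (cos_pos_of_mem_Ioo_zero hθ) (cos_pos_of_mem_Ioo_zero hθ')
  have hradius : ∀ p : ℝ × ℝ, ENNReal.ofReal p.1 =
      ENNReal.ofReal (Real.cos θ / Real.cos θ') * ENNReal.ofReal (stretch θ θ' p).1 := fun p => by
    rw [← ENNReal.ofReal_mul hscale.le, stretch_fst hθ hθ', ← mul_assoc,
      div_mul_div_cancel₀ (cos_pos_of_mem_Ioo_zero hθ').ne',
      div_self (cos_pos_of_mem_Ioo_zero hθ).ne', one_mul]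
  have hvol : (volume.restrict (Gui θ)).map (stretch θ θ') =
      ENNReal.ofReal |(LinearMap.det (stretch θ θ' : ℝ × ℝ →ₗ[ℝ] ℝ × ℝ))⁻¹| •
        volume.restrict (Gui θ') := by
    have hpre : Gui θ = stretch θ θ' ⁻¹' Gui θ' :=
      Set.ext fun _ => (stretch_mem_Gui_iff hθ hθ').symm
    rw [hpre, ← hme.restrict_map, ← Measure.restrict_smul]
    exact congrArg (fun μ : Measure (ℝ × ℝ) => μ.restrict (Gui θ'))
      (Measure.map_linearMap_addHaar_eq_smul_addHaar volume (det_stretch_ne_zero hθ hθ'))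
  refine Measure.ext fun S hS => ?_
  rw [hme.map_apply, guiMeasure, withDensity_apply _ (hme.measurable hS), lintegral_congr hradius,
    ← hme.lintegral_map
      fun q => ENNReal.ofReal (Real.cos θ / Real.cos θ') * ENNReal.ofReal q.1,
    ← hme.restrict_map, hvol, lintegral_const_mul _ (by fun_prop), Measure.restrict_smul,
    lintegral_smul_measure, Measure.smul_apply, guiMeasure, withDensity_apply _ hS, stretchFactor,
    ENNReal.ofReal_mul hscale.le, smul_eq_mul, smul_eq_mul, mul_assoc]

theorem integral_comp_stretch (hθ : θ ∈ Set.Ioo 0 (Real.pi / 2))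
    (hθ' : θ' ∈ Set.Ioo 0 (Real.pi / 2)) {E : Type*} [NormedAddCommGroup E] [NormedSpace ℝ E]
    (f : ℝ × ℝ → E) :
    ∫ p, f (stretch θ θ' p) ∂guiMeasure θ = stretchFactor θ θ' • ∫ q, f q ∂guiMeasure θ' := by
  rw [← (measurableEmbedding_stretch hθ hθ').integral_map, map_stretch_guiMeasure hθ hθ',
    integral_smul_measure, ENNReal.toReal_ofReal (stretchFactor_pos hθ hθ').le]

theorem eLpNorm_comp_stretch (hθ : θ ∈ Set.Ioo 0 (Real.pi / 2))
    (hθ' : θ' ∈ Set.Ioo 0 (Real.pi / 2)) {E : Type*} [NormedAddCommGroup E] {q : ENNReal}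
    (hq : q ≠ ⊤) (f : ℝ × ℝ → E) :
    eLpNorm (fun p => f (stretch θ θ' p)) q (guiMeasure θ) =
      ENNReal.ofReal (stretchFactor θ θ') ^ (1 / q).toReal * eLpNorm f q (guiMeasure θ') := by
  rw [← smul_eq_mul, ← eLpNorm_smul_measure_of_ne_top hq, ← map_stretch_guiMeasure hθ hθ',
    (measurableEmbedding_stretch hθ hθ').eLpNorm_map_measure]
  rfl

theorem quasiMeasurePreserving_stretch (hθ : θ ∈ Set.Ioo 0 (Real.pi / 2))
    (hθ' : θ' ∈ Set.Ioo 0 (Real.pi / 2)) :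
    Measure.QuasiMeasurePreserving (stretch θ θ') (guiMeasure θ) (guiMeasure θ') :=
  ⟨(stretch θ θ').measurable,
    map_stretch_guiMeasure hθ hθ' ▸ Measure.smul_absolutelyContinuous⟩

theorem memLp_comp_stretch (hθ : θ ∈ Set.Ioo 0 (Real.pi / 2))
    (hθ' : θ' ∈ Set.Ioo 0 (Real.pi / 2)) {E : Type*} [NormedAddCommGroup E] {q : ENNReal}
    {f : ℝ × ℝ → E} (hf : MemLp f q (guiMeasure θ')) :
    MemLp (fun p => f (stretch θ θ' p)) q (guiMeasure θ) := by
  refine (measurableEmbedding_stretch hθ hθ').memLp_map_measure_iff.1 ?_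
  rw [map_stretch_guiMeasure hθ hθ']
  exact hf.smul_measure ENNReal.ofReal_ne_top

end ChangeOfVariables

section FormComparison

variable {θ θ' ω ω' C : ℝ}

theorem IsGuiTestFunction.comp_stretch (hθ : θ ∈ Set.Ioo 0 (Real.pi / 2))
    (hθ' : θ' ∈ Set.Ioo 0 (Real.pi / 2)) {w : ℝ × ℝ → ℂ} (hw : IsGuiTestFunction θ' w) :
    IsGuiTestFunction θ fun p => w (stretch θ θ' p) := by
  obtain ⟨h, K, hK, hKG, h0⟩ := hw
  refine ⟨h.comp (stretch θ θ').contDiff, stretch θ' θ '' K, hK.image (stretch θ' θ).continuous,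
    ?_, fun p hp => h0 _ fun hpK => hp ⟨_, hpK, leftInverse_stretch hθ hθ' p⟩⟩
  rintro _ ⟨q, hq, rfl⟩
  exact (stretch_mem_Gui_iff hθ' hθ).2 (hKG hq)

theorem sum_sq_norm_comp_stretch_le {F : Type*} [NormedAddCommGroup F] [InnerProductSpace ℝ F]
    (hC : 1 ≤ C) (htan : (Real.tan θ / Real.tan θ') ^ 2 ≤ C) (T : ℝ × ℝ →L[ℝ] F) :
    ‖T (stretch θ θ' (1, 0))‖ ^ 2 + ‖T (stretch θ θ' (0, 1))‖ ^ 2 ≤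
      C * (‖T (1, 0)‖ ^ 2 + ‖T (0, 1)‖ ^ 2) := by
  have hside := sq_norm_add_sq_norm_eq_side (T.comp (stretch θ θ')) θ
  simp only [ContinuousLinearMap.comp_apply, stretch_sideNormal, stretch_sideTangent, map_smul,
    norm_smul, mul_pow, Real.norm_eq_abs, sq_abs] at hside
  rw [hside, sq_norm_add_sq_norm_eq_side T θ', mul_add]
  gcongr
  exact le_mul_of_one_le_left (sq_nonneg _) hC

theorem sum_fiberGradient_comp_stretch_le (hθ : θ ∈ Set.Ioo 0 (Real.pi / 2))
    (hθ' : θ' ∈ Set.Ioo 0 (Real.pi / 2)) (hC : 1 ≤ C)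
    (htan : (Real.tan θ / Real.tan θ') ^ 2 ≤ C)
    (hω : (Real.cos θ' / Real.cos θ * ω) ^ 2 ≤ C * ω' ^ 2)
    {w : ℝ × ℝ → ℂ} (hw : Differentiable ℝ w) (p : ℝ × ℝ) :
    ∑ i, ‖fiberGradient ω (fun p => w (stretch θ θ' p)) i p‖ ^ 2 ≤
      C * ∑ i, ‖fiberGradient ω' w i (stretch θ θ' p)‖ ^ 2 := by
  have hderiv : fderiv ℝ (fun p => w (stretch θ θ' p)) p =
      (fderiv ℝ w (stretch θ θ' p)).comp (stretch θ θ') :=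
    ((hw _).hasFDerivAt.comp p (stretch θ θ').hasFDerivAt).fderiv
  have hpot : (ω * p.1⁻¹) ^ 2 ≤ C * (ω' * (stretch θ θ' p).1⁻¹) ^ 2 := by
    have hc := (cos_pos_of_mem_Ioo_zero hθ).ne'
    have hc' := (cos_pos_of_mem_Ioo_zero hθ').ne'
    calc (ω * p.1⁻¹) ^ 2
        = (Real.cos θ' / Real.cos θ * ω) ^ 2 * (stretch θ θ' p).1⁻¹ ^ 2 := by
          rw [stretch_fst hθ hθ']
          field_simp
      _ ≤ C * ω' ^ 2 * (stretch θ θ' p).1⁻¹ ^ 2 := by gcongr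
      _ = C * (ω' * (stretch θ θ' p).1⁻¹) ^ 2 := by ring
  simp only [Fin.sum_univ_three, fiberGradient, Matrix.cons_val, hderiv,
    ContinuousLinearMap.comp_apply, norm_mul, mul_pow, Complex.norm_real, Real.norm_eq_abs,
    sq_abs]
  simp only [mul_pow] at hpot
  rw [mul_add, ← mul_assoc C]
  gcongr
  exact sum_sq_norm_comp_stretch_le hC htan _

theorem IsGuiTestFunction.fiberForm₀_eq_integral {w : ℝ × ℝ → ℂ} (hw : IsGuiTestFunction θ w)
    (ω : ℝ) : fiberForm₀ ω θ w = ∫ p, ∑ i, ‖fiberGradient ω w i p‖ ^ 2 ∂guiMeasure θ := by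
  rw [integral_finsetSum _ fun i _ =>
    (hw.memLp_fiberGradient ω i).integrable_norm_pow two_ne_zero]
  simp only [integral_norm_sq_eq_sq_eLpNorm (hw.memLp_fiberGradient ω _), fiberForm₀]

theorem IsGuiTestFunction.integrable_sum_fiberGradient {w : ℝ × ℝ → ℂ}
    (hw : IsGuiTestFunction θ w) (ω : ℝ) :
    Integrable (fun p => ∑ i, ‖fiberGradient ω w i p‖ ^ 2) (guiMeasure θ) :=
  integrable_finsetSum _ fun i _ =>
    (hw.memLp_fiberGradient ω i).integrable_norm_pow two_ne_zero

theorem IsGuiTestFunction.fiberForm₀_comp_stretch_le (hθ : θ ∈ Set.Ioo 0 (Real.pi / 2))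
    (hθ' : θ' ∈ Set.Ioo 0 (Real.pi / 2)) (hC : 1 ≤ C)
    (htan : (Real.tan θ / Real.tan θ') ^ 2 ≤ C)
    (hω : (Real.cos θ' / Real.cos θ * ω) ^ 2 ≤ C * ω' ^ 2)
    {w : ℝ × ℝ → ℂ} (hw : IsGuiTestFunction θ' w) :
    fiberForm₀ ω θ (fun p => w (stretch θ θ' p)) ≤
      C * (stretchFactor θ θ' * fiberForm₀ ω' θ' w) := by
  have hint : Integrable (fun p => ∑ i, ‖fiberGradient ω' w i (stretch θ θ' p)‖ ^ 2)
      (guiMeasure θ) := memLp_one_iff_integrable.1 (memLp_comp_stretch hθ hθ'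
        (f := fun q => ∑ i, ‖fiberGradient ω' w i q‖ ^ 2)
        (memLp_one_iff_integrable.2 (hw.integrable_sum_fiberGradient ω')))
  calc fiberForm₀ ω θ (fun p => w (stretch θ θ' p))
      = ∫ p, ∑ i, ‖fiberGradient ω (fun p => w (stretch θ θ' p)) i p‖ ^ 2 ∂guiMeasure θ :=
        (hw.comp_stretch hθ hθ').fiberForm₀_eq_integral ω
    _ ≤ ∫ p, C * ∑ i, ‖fiberGradient ω' w i (stretch θ θ' p)‖ ^ 2 ∂guiMeasure θ :=
        integral_mono ((hw.comp_stretch hθ hθ').integrable_sum_fiberGradient ω) (hint.const_mul C)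
          (sum_fiberGradient_comp_stretch_le hθ hθ' hC htan hω hw.differentiable)
    _ = C * (stretchFactor θ θ' * fiberForm₀ ω' θ' w) := by
        rw [integral_const_mul, integral_comp_stretch hθ hθ'
          (fun q => ∑ i, ‖fiberGradient ω' w i q‖ ^ 2), smul_eq_mul, hw.fiberForm₀_eq_integral]

theorem IsFormApprox.comp_stretch (hθ : θ ∈ Set.Ioo 0 (Real.pi / 2))
    (hθ' : θ' ∈ Set.Ioo 0 (Real.pi / 2)) (hω' : ω' ≠ 0) {w : ℕ → ℝ × ℝ → ℂ} {g : ℝ × ℝ → ℂ}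
    (h : IsFormApprox ω' θ' w g) (ω : ℝ) :
    IsFormApprox ω θ (fun n p => w n (stretch θ θ' p)) fun p => g (stretch θ θ' p) := by
  refine ⟨fun n => (h.test n).comp_stretch hθ hθ', ?_, ?_⟩
  · have hlim := ENNReal.Tendsto.const_mul
      (a := ENNReal.ofReal (stretchFactor θ θ') ^ (1 / (2 : ENNReal)).toReal) h.tendsto
      (Or.inr (by simp))
    rw [mul_zero] at hlim
    exact hlim.congr fun n =>
      (eLpNorm_comp_stretch hθ hθ' ENNReal.ofNat_ne_top fun q => w n q - g q).symm
  · obtain ⟨C, hC, htan, hω⟩ : ∃ C : ℝ, 1 ≤ C ∧ (Real.tan θ / Real.tan θ') ^ 2 ≤ C ∧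
        (Real.cos θ' / Real.cos θ * ω) ^ 2 ≤ C * ω' ^ 2 := by
      refine ⟨max 1 (max ((Real.tan θ / Real.tan θ') ^ 2)
        ((Real.cos θ' / Real.cos θ * ω) ^ 2 / ω' ^ 2)), le_max_left _ _,
        le_max_of_le_right (le_max_left _ _), ?_⟩
      rw [← div_le_iff₀ (by positivity)]
      exact le_max_of_le_right (le_max_right _ _)
    have hlim := (h.cauchy.const_mul (stretchFactor θ θ')).const_mul C
    rw [mul_zero, mul_zero] at hlim
    exact squeeze_zero (fun _ => Finset.sum_nonneg fun _ _ => sq_nonneg _)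
      (fun m => ((h.test m.1).sub (h.test m.2)).fiberForm₀_comp_stretch_le hθ hθ' hC htan hω) hlim

end FormComparison

section CompStretch

variable {θ θ' ω ω' : ℝ}

theorem toLp_comp_stretch_toLp_comp_stretch (hθ : θ ∈ Set.Ioo 0 (Real.pi / 2))
    (hθ' : θ' ∈ Set.Ioo 0 (Real.pi / 2)) (u : L2Gui θ) :
    (memLp_comp_stretch hθ hθ' (Lp.memLp
      (memLp_comp_stretch hθ' hθ (Lp.memLp u)).toLp)).toLp = u := by
  refine Lp.ext ?_
  filter_upwards [MemLp.coeFn_toLp (memLp_comp_stretch hθ hθ' (Lp.memLp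
      (memLp_comp_stretch hθ' hθ (Lp.memLp u)).toLp)),
    (quasiMeasurePreserving_stretch hθ hθ').ae
      (memLp_comp_stretch hθ' hθ (Lp.memLp u)).coeFn_toLp] with p hp hp'
  have hinv := leftInverse_stretch hθ hθ' p
  exact hp.trans (hp'.trans (congrArg u hinv))

/-- The bijection `u ↦ u ∘ stretch θ θ'` from `L²(Gui(θ'))` to `L²(Gui(θ))`, which is unitary up to
a scalar. -/
def compStretch (hθ : θ ∈ Set.Ioo 0 (Real.pi / 2)) (hθ' : θ' ∈ Set.Ioo 0 (Real.pi / 2)) :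
    L2Gui θ' ≃ L2Gui θ where
  toFun u := (memLp_comp_stretch hθ hθ' (Lp.memLp u)).toLp
  invFun u := (memLp_comp_stretch hθ' hθ (Lp.memLp u)).toLp
  left_inv := toLp_comp_stretch_toLp_comp_stretch hθ' hθ
  right_inv := toLp_comp_stretch_toLp_comp_stretch hθ hθ'

theorem coeFn_compStretch (hθ : θ ∈ Set.Ioo 0 (Real.pi / 2)) (hθ' : θ' ∈ Set.Ioo 0 (Real.pi / 2))
    (u : L2Gui θ') : compStretch hθ hθ' u =ᵐ[guiMeasure θ] fun p => u (stretch θ θ' p) :=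
  (memLp_comp_stretch hθ hθ' (Lp.memLp u)).coeFn_toLp

theorem inner_compStretch (hθ : θ ∈ Set.Ioo 0 (Real.pi / 2)) (hθ' : θ' ∈ Set.Ioo 0 (Real.pi / 2))
    (u v : L2Gui θ') :
    inner ℂ (compStretch hθ hθ' u) (compStretch hθ hθ' v) = stretchFactor θ θ' * inner ℂ u v := by
  rw [L2.inner_def, L2.inner_def, ← Complex.real_smul,
    ← integral_comp_stretch hθ hθ' fun q => inner ℂ (u q) (v q)]
  refine integral_congr_ae ?_
  filter_upwards [coeFn_compStretch hθ hθ' u, coeFn_compStretch hθ hθ' v] with p hu hv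
  rw [hu, hv]

theorem IsFormApprox.compStretch (hθ : θ ∈ Set.Ioo 0 (Real.pi / 2))
    (hθ' : θ' ∈ Set.Ioo 0 (Real.pi / 2)) (hω' : ω' ≠ 0) {w : ℕ → ℝ × ℝ → ℂ} {u : L2Gui θ'}
    (h : IsFormApprox ω' θ' w u) (ω : ℝ) :
    IsFormApprox ω θ (fun n p => w n (stretch θ θ' p)) (compStretch hθ hθ' u) :=
  (h.comp_stretch hθ hθ' hω' ω).congr (coeFn_compStretch hθ hθ' u).symm

theorem compStretch_mem_fiberDomain (hθ : θ ∈ Set.Ioo 0 (Real.pi / 2))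
    (hθ' : θ' ∈ Set.Ioo 0 (Real.pi / 2)) (hω' : ω' ≠ 0) {u : L2Gui θ'}
    (hu : u ∈ fiberDomain ω' θ') (ω : ℝ) : compStretch hθ hθ' u ∈ fiberDomain ω θ :=
  let ⟨_, hw⟩ := mem_fiberDomain_iff.1 hu
  (hw.compStretch hθ hθ' hω' ω).mem_fiberDomain

theorem compStretch_mem_fiberDomain_iff (hθ : θ ∈ Set.Ioo 0 (Real.pi / 2))
    (hθ' : θ' ∈ Set.Ioo 0 (Real.pi / 2)) (hω : ω ≠ 0) (hω' : ω' ≠ 0) {u : L2Gui θ'} :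
    compStretch hθ hθ' u ∈ fiberDomain ω θ ↔ u ∈ fiberDomain ω' θ' :=
  ⟨fun hu => (compStretch hθ hθ').symm_apply_apply u ▸
    compStretch_mem_fiberDomain hθ' hθ hω hu ω',
    fun hu => compStretch_mem_fiberDomain hθ hθ' hω' hu ω⟩

theorem fiberForm_compStretch_le (hθ : θ ∈ Set.Ioo 0 (Real.pi / 2))
    (hθ' : θ' ∈ Set.Ioo 0 (Real.pi / 2)) (hω' : ω' ≠ 0) {C : ℝ} (hC : 1 ≤ C)
    (htan : (Real.tan θ / Real.tan θ') ^ 2 ≤ C)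
    (hω : (Real.cos θ' / Real.cos θ * ω) ^ 2 ≤ C * ω' ^ 2)
    {u : L2Gui θ'} (hu : u ∈ fiberDomain ω' θ') :
    fiberForm ω θ (compStretch hθ hθ' u) ≤ C * (stretchFactor θ θ' * fiberForm ω' θ' u) := by
  obtain ⟨w, hw⟩ := mem_fiberDomain_iff.1 hu
  exact le_of_tendsto_of_tendsto' (hw.compStretch hθ hθ' hω' ω).tendsto_fiberForm₀
    ((hw.tendsto_fiberForm₀.const_mul _).const_mul C)
    fun n => (hw.test n).fiberForm₀_comp_stretch_le hθ hθ' hC htan hω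

end CompStretch

end ConicalLayer

end

open ConicalLayer in
theorem proposition1p3_general {θ₁ θ₂ ω₁ ω₂ : ℝ} (hθ₁ : 0 < θ₁) (hθ : θ₁ ≤ θ₂)
    (hθ₂ : θ₂ < Real.pi / 2) (hω₁ : ω₁ ≠ 0)
    (hω : Real.cos θ₂ * (Real.cos θ₁)⁻¹ * |ω₁| ≤ |ω₂|) (k : ℕ) :
    fiberRayleigh ω₁ θ₁ (k + 1) ≤ fiberRayleigh ω₂ θ₂ (k + 1) := by
  have h₁ : θ₁ ∈ Set.Ioo 0 (Real.pi / 2) := ⟨hθ₁, hθ.trans_lt hθ₂⟩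
  have h₂ : θ₂ ∈ Set.Ioo 0 (Real.pi / 2) := ⟨hθ₁.trans_le hθ, hθ₂⟩
  have hscale : 0 < Real.cos θ₂ * (Real.cos θ₁)⁻¹ :=
    mul_pos (cos_pos_of_mem_Ioo_zero h₂) (inv_pos.2 (cos_pos_of_mem_Ioo_zero h₁))
  have hω₂ : ω₂ ≠ 0 := abs_pos.1 ((mul_pos hscale (abs_pos.2 hω₁)).trans_le hω)
  have htan : (Real.tan θ₁ / Real.tan θ₂) ^ 2 ≤ 1 := by
    have htan₁ := Real.tan_pos_of_pos_of_lt_pi_div_two h₁.1 h₁.2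
    have hmono : Real.tan θ₁ ≤ Real.tan θ₂ := Real.strictMonoOn_tan.monotoneOn
      ⟨by linarith [Real.pi_pos], h₁.2⟩ ⟨by linarith [Real.pi_pos, h₂.1], h₂.2⟩ hθ
    have htan₂ := htan₁.trans_le hmono
    exact pow_le_one₀ (by positivity) ((div_le_one htan₂).2 hmono)
  have hpot : (Real.cos θ₂ / Real.cos θ₁ * ω₁) ^ 2 ≤ 1 * ω₂ ^ 2 := by
    rw [one_mul, div_eq_mul_inv, sq_le_sq, abs_mul, abs_of_pos hscale]
    exact hω
  refine rayleighQuotient_le_of_equiv (compStretch h₁ h₂) (stretchFactor_pos h₁ h₂)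
    (inner_compStretch h₁ h₂) (fun _ => compStretch_mem_fiberDomain_iff h₁ h₂ hω₁ hω₂)
    (fun u hu => ?_) (k + 1)
  simpa only [one_mul] using fiberForm_compStretch_le h₁ h₂ hω₂ le_rfl htan hpot hu

theorem proposition1p3 (θ₁ θ₂ ω₁ ω₂ : ℝ)
    (hθ₁ : 0 < θ₁) (hθ : θ₁ ≤ θ₂) (hθ₂ : θ₂ < Real.pi / 2)
    (hω₁ : ω₁ ∈ Set.Ioc (0 : ℝ) (1 / 2))
    (hω₂ : ω₂ ∈ Set.Icc (Real.cos θ₂ * (Real.cos θ₁)⁻¹ * ω₁) (1 / 2)) (k : ℕ) (hk : 1 ≤ k) :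
    ConicalLayer.fiberRayleigh ω₁ θ₁ k ≤ ConicalLayer.fiberRayleigh ω₂ θ₂ k := by
  obtain ⟨n, rfl⟩ := Nat.exists_eq_add_of_le' hk
  refine proposition1p3_general hθ₁ hθ hθ₂ hω₁.1.ne' ?_ n
  rw [abs_of_pos hω₁.1]
  exact hω₂.1.trans (le_abs_self ω₂)
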